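/- Let $k$ be a field and let $D$ be a coassociative counital coalgebra over $k$. A right (left) $D$-comodule is called \emph{finitely cogenerated} if it embeds as a subcomodule into a cofree comodule $V\otimes_k D$ (respectively $D\otimes_k V$) with $\dim_k V<\infty$, and a right $D$-comodule is called \emph{finitely copresented} if it is the kernel of a morphism $V\otimes_k D\to W\otimes_k D$ with $\dim_k V,\dim_k W<\infty$. Assume that $D$ is \emph{right cocoherent}, i.e. every finitely cogenerated quotient comodule of a finitely copresented right $D$-comodule is finitely copresented, and \emph{left co-Noetherian}, i.e. every quotient comodule of a finitely cogenerated left $D$-comodule is finitely cogenerated. A left $D$-contramodule is a $k$-vector space $P$ with a contraassociative and contraunital contraaction map $\operatorname{Hom}_k(D,P)\to P$. The contratensor product $N\odot_D P$ of a right $D$-comodule $N$ and a left $D$-contramodule $P$ is the cokernel of the difference of the two maps $N\otimes_k\operatorname{Hom}_k(D,P)\rightrightarrows N\otimes_k P$, one induced by the contraaction in $P$ and the other induced by the coaction $N\to N\otimes_k D$ and the evaluation map $D\otimes_k\operatorname{Hom}_k(D,P)\to P$. For a complex $N^\bullet$ of right $D$-comodules and a left $D$-contramodule $P$ put $\operatorname{Ctrtor}^D_n(N^\bullet,P)=H^{-n}(N^\bullet\odot_D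 F^\bullet)$, where $F^\bullet$ is a projective resolution of $P$ in the abelian category of left $D$-contramodules and the bicomplex is totalized by direct sums. Let $N^\bullet$ be a finite complex of right $D$-comodules. Say that $N^\bullet$ has \emph{projective dimension $\le d$} if $\operatorname{Hom}_{\mathsf D^b}(N^\bullet,M[n])=0$ for all right $D$-comodules $M$ and all integers $n>d$, where $\mathsf D^b$ is the bounded derived category of right $D$-comodules, and that $N^\bullet$ has \emph{contraflat dimension $\le d$} if $\operatorname{Ctrtor}^D_n(N^\bullet,P)=0$ for all left $D$-contramodules $P$ and all integers $n>d$. Then the contraflat dimension of $N^\bullet$ does not exceed its projective dimension: for every integer $d$, if $N^\bullet$ has projective dimension $\le d$, then $N^\bullet$ has contraflat dimension $\le d$. -/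

import Mathlib

open CategoryTheory CategoryTheory.Limits
open scoped TensorProduct

universe u

namespace ComodContra

noncomputable section

/-! ### Abelian categories of (co)algebras over exact additive (co)monads -/

/-- A preadditive category with finite products, kernels and cokernels is abelian as soon as it has
an exact functor to an abelian category which reflects isomorphisms. -/
abbrev abelianOfForget {A B : Type*} [Category* A] [Category* B] [Preadditive A] [Abelian B]
    [HasFiniteProducts A] [HasKernels A] [HasCokernels A]
    (F : A ⥤ B) [F.PreservesZeroMorphisms] [PreservesFiniteLimits F] [PreservesFiniteColimits F]
    [F.ReflectsIsomorphisms] : Abelian A := by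
  have : ∀ {X Y : A} (f : X ⟶ Y), IsIso (Abelian.coimageImageComparison f) := by
    intro X Y f
    have h := (Abelian.PreservesCoimageImageComparison.iso F f)
    have : IsIso (F.map (Abelian.coimageImageComparison f)) := by
      exact (Arrow.isIso_iff_isIso_of_isIso h.hom).2
        (inferInstanceAs (IsIso (Abelian.coimageImageComparison (F.map f))))
    exact isIso_of_reflects_iso _ F
  exact Abelian.ofCoimageImageComparisonIsIso

/-- Every additive functor between categories of vector spaces is exact. -/
theorem exact_of_additive {k : Type u} [Field k] (F : ModuleCat.{u} k ⥤ ModuleCat.{u} k)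
    [F.Additive] : PreservesFiniteLimits F ∧ PreservesFiniteColimits F := by
  refine ((Functor.exact_tfae F).out 0 3).1 ?_
  intro S hS
  have : Projective S.X₃ := ModuleCat.projective_of_free (Module.Free.chooseBasis k S.X₃)
  exact (hS.splittingOfProjective.map F).shortExact

section

variable {k : Type u} [Field k]

abbrev abelianCoalgebra (G : Comonad (ModuleCat.{u} k)) [G.toFunctor.Additive] :
    Abelian G.Coalgebra := by
  have : PreservesFiniteLimits G.toFunctor := (exact_of_additive _).1
  have : HasFiniteLimits G.Coalgebra := ⟨fun J _ _ =>
    hasLimitsOfShape_of_hasLimitsOfShape_createsLimitsOfShape G.forget⟩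
  have : HasFiniteColimits G.Coalgebra := ⟨fun J _ _ =>
    hasColimitsOfShape_of_hasColimitsOfShape_createsColimitsOfShape G.forget⟩
  have : PreservesFiniteLimits G.forget := ⟨fun J _ _ => inferInstance⟩
  have : PreservesFiniteColimits G.forget := ⟨fun J _ _ => inferInstance⟩
  exact abelianOfForget G.forget

abbrev abelianAlgebra (T : Monad (ModuleCat.{u} k)) [T.toFunctor.Additive] :
    Abelian T.Algebra := by
  have : PreservesFiniteColimits T.toFunctor := (exact_of_additive _).2
  have : HasFiniteLimits T.Algebra := ⟨fun J _ _ =>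
    hasLimitsOfShape_of_hasLimitsOfShape_createsLimitsOfShape T.forget⟩
  have : HasFiniteColimits T.Algebra := ⟨fun J _ _ =>
    hasColimitsOfShape_of_hasColimitsOfShape_createsColimitsOfShape T.forget⟩
  have : PreservesFiniteLimits T.forget := ⟨fun J _ _ => inferInstance⟩
  have : PreservesFiniteColimits T.forget := ⟨fun J _ _ => inferInstance⟩
  exact abelianOfForget T.forget

end

/-! ### Comodules and contramodules over a coalgebra `D` over a field `k` -/

variable (k : Type u) [Field k] (D : Type u) [AddCommGroup D] [Module k D] [Coalgebra k D]

open Coalgebra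

section

variable (V : Type u) [AddCommGroup V] [Module k V]

/-- The linear map `v ⊗ x ↦ ε(x) v`. -/
def rightCounit : V ⊗[k] D →ₗ[k] V :=
  (TensorProduct.rid k V).toLinearMap ∘ₗ (counit (R := k) (A := D)).lTensor V

/-- The linear map `v ⊗ x ↦ (v ⊗ x₍₁₎) ⊗ x₍₂₎`. -/
def rightComul : V ⊗[k] D →ₗ[k] (V ⊗[k] D) ⊗[k] D :=
  (TensorProduct.assoc k V D D).symm.toLinearMap ∘ₗ (comul (R := k) (A := D)).lTensor V

/-- The linear map `x ⊗ v ↦ ε(x) v`. -/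
def leftCounit : D ⊗[k] V →ₗ[k] V :=
  (TensorProduct.lid k V).toLinearMap ∘ₗ (counit (R := k) (A := D)).rTensor V

/-- The linear map `x ⊗ v ↦ x₍₁₎ ⊗ (x₍₂₎ ⊗ v)`. -/
def leftComul : D ⊗[k] V →ₗ[k] D ⊗[k] (D ⊗[k] V) :=
  (TensorProduct.assoc k D D V).toLinearMap ∘ₗ (comul (R := k) (A := D)).rTensor V

/-- The linear map `v ↦ (x ↦ ε(x) v)`. -/
def contraUnit : V →ₗ[k] (D →ₗ[k] V) where
  toFun v := (counit (R := k) (A := D)).smulRight v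
  map_add' v w := by ext; simp
  map_smul' c v := by ext x; exact smul_comm _ _ _

/-- The composite `Hom(D, Hom(D, V)) ≃ Hom(D ⊗ D, V) → Hom(D, V)` of `f ↦ (x ⊗ y ↦ f y x)` with the
map induced by the comultiplication of `D`; in Sweedler notation, `f ↦ (x ↦ f x₍₂₎ x₍₁₎)`. -/
def contraMul : (D →ₗ[k] (D →ₗ[k] V)) →ₗ[k] (D →ₗ[k] V) where
  toFun f := TensorProduct.lift f.flip ∘ₗ comul
  map_add' f g := by
    rw [← LinearMap.add_comp]; congr 1; ext; simp
  map_smul' c f := by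
    rw [RingHom.id_apply, ← LinearMap.smul_comp]; congr 1; ext; simp

variable {V}

theorem rightComul_tmul (v : V) (x : D) {ι : Type*} (s : Finset ι) (a b : ι → D)
    (h : ∑ i ∈ s, a i ⊗ₜ[k] b i = comul x) :
    rightComul k D V (v ⊗ₜ x) = ∑ i ∈ s, (v ⊗ₜ a i) ⊗ₜ b i := by
  simp [rightComul, ← h, TensorProduct.tmul_sum]

theorem leftComul_tmul (v : V) (x : D) {ι : Type*} (s : Finset ι) (a b : ι → D)
    (h : ∑ i ∈ s, a i ⊗ₜ[k] b i = comul x) :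
    leftComul k D V (x ⊗ₜ v) = ∑ i ∈ s, a i ⊗ₜ (b i ⊗ₜ v) := by
  simp [leftComul, ← h, TensorProduct.sum_tmul]

theorem contraMul_apply (f : D →ₗ[k] (D →ₗ[k] V)) (x : D) {ι : Type*} (s : Finset ι) (a b : ι → D)
    (h : ∑ i ∈ s, a i ⊗ₜ[k] b i = comul x) :
    contraMul k D V f x = ∑ i ∈ s, f (b i) (a i) := by
  simp [contraMul, ← h]

theorem sum_trilinear_eq (T : D →ₗ[k] D →ₗ[k] D →ₗ[k] V) (x : D) :
    ∑ i ∈ (ℛ k x).index, ∑ j ∈ (ℛ k ((ℛ k x).left i)).index,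
        T ((ℛ k ((ℛ k x).left i)).left j) ((ℛ k ((ℛ k x).left i)).right j) ((ℛ k x).right i) =
      ∑ i ∈ (ℛ k x).index, ∑ j ∈ (ℛ k ((ℛ k x).right i)).index,
        T ((ℛ k x).left i) ((ℛ k ((ℛ k x).right i)).left j)
          ((ℛ k ((ℛ k x).right i)).right j) := by
  have h := congrArg (TensorProduct.lift (TensorProduct.uncurry (.id k) D D V ∘ₗ T))
    (sum_tmul_tmul_eq (ℛ k x) (fun i => ℛ k ((ℛ k x).left i)) (fun i => ℛ k ((ℛ k x).right i)))
  simpa using h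

theorem rightComul_coassoc (t : V ⊗[k] D) :
    (rightComul k D V).rTensor D (rightComul k D V t) =
      rightComul k D (V ⊗[k] D) (rightComul k D V t) := by
  induction t with
  | zero => simp
  | add a b ha hb => simp only [map_add, ha, hb]
  | tmul v x =>
    have h := sum_trilinear_eq k D (V := ((V ⊗[k] D) ⊗[k] D) ⊗[k] D)
      (LinearMap.mk₂ k (fun a b => TensorProduct.mk k _ _ ((v ⊗ₜ a) ⊗ₜ b))
        (by intros; simp [TensorProduct.tmul_add, TensorProduct.add_tmul])
        (by intros; rw [TensorProduct.tmul_smul, ← TensorProduct.smul_tmul', map_smul])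
        (by intros; simp [TensorProduct.tmul_add]) (by intros; simp)) x
    rw [rightComul_tmul k D v x _ _ _ (ℛ k x).eq, map_sum, map_sum]
    simp only [LinearMap.rTensor_tmul, fun y => rightComul_tmul k D v y _ _ _ (ℛ k y).eq,
      fun w y => rightComul_tmul k D (V := V ⊗[k] D) w y _ _ _ (ℛ k y).eq,
      TensorProduct.sum_tmul]
    simpa using h

theorem leftComul_coassoc (t : D ⊗[k] V) :
    (leftComul k D V).lTensor D (leftComul k D V t) =
      leftComul k D (D ⊗[k] V) (leftComul k D V t) := by
  induction t with
  | zero => simp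
  | add a b ha hb => simp only [map_add, ha, hb]
  | tmul x v =>
    have h := sum_trilinear_eq k D (V := D ⊗[k] (D ⊗[k] (D ⊗[k] V)))
      (LinearMap.mk₂ k (fun a b => TensorProduct.mk k _ _ a ∘ₗ TensorProduct.mk k _ _ b ∘ₗ
          (TensorProduct.mk k D V).flip v)
        (by intros; ext; simp)
        (by intros; ext; simp [TensorProduct.smul_tmul'])
        (by intros; ext; simp [TensorProduct.tmul_add])
        (by intros; ext; simp only [LinearMap.comp_apply, LinearMap.smul_apply,
              TensorProduct.mk_apply, ← TensorProduct.smul_tmul', TensorProduct.tmul_smul])) x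
    rw [leftComul_tmul k D v x _ _ _ (ℛ k x).eq, map_sum, map_sum]
    simp only [LinearMap.lTensor_tmul, fun y => leftComul_tmul k D v y _ _ _ (ℛ k y).eq,
      fun w y => leftComul_tmul k D (V := D ⊗[k] V) w y _ _ _ (ℛ k y).eq,
      TensorProduct.tmul_sum]
    simpa using h.symm

theorem contraMul_assoc (f : D →ₗ[k] D →ₗ[k] D →ₗ[k] V) :
    contraMul k D V (contraMul k D V ∘ₗ f) =
      contraMul k D V (contraMul k D (D →ₗ[k] V) f) := by
  ext x
  have h := sum_trilinear_eq k D (V := V)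
      (LinearMap.mk₂ k (fun a b => LinearMap.applyₗ a ∘ₗ LinearMap.applyₗ b ∘ₗ f)
        (by intros; ext; simp) (by intros; ext; simp)
        (by intros; ext; simp) (by intros; ext; simp)) x
  simp only [fun f y => contraMul_apply k D (V := V) f y _ _ _ (ℛ k y).eq,
      fun f y => contraMul_apply k D (V := D →ₗ[k] V) f y _ _ _ (ℛ k y).eq, LinearMap.comp_apply,
      LinearMap.sum_apply]
  simpa using h

theorem sum_counit_smul' (x : D) :
    ∑ i ∈ (ℛ k x).index, counit (R := k) ((ℛ k x).right i) • (ℛ k x).left i = x := by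
  have h := congrArg (TensorProduct.rid k D) (sum_tmul_counit_eq (ℛ k x))
  simpa only [map_sum, TensorProduct.rid_tmul, one_smul] using h

theorem rightComul_counit (t : V ⊗[k] D) :
    rightCounit k D (V ⊗[k] D) (rightComul k D V t) = t := by
  induction t with
  | zero => simp
  | add a b ha hb => simp only [map_add, ha, hb]
  | tmul v x =>
    rw [rightComul_tmul k D v x _ _ _ (ℛ k x).eq]
    simp only [rightCounit, map_sum, LinearMap.comp_apply, LinearMap.lTensor_tmul,
      LinearEquiv.coe_coe, TensorProduct.rid_tmul, ← TensorProduct.tmul_smul,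
      ← TensorProduct.tmul_sum]
    rw [sum_counit_smul' k D]

theorem rightComul_map_counit (t : V ⊗[k] D) :
    (rightCounit k D V).rTensor D (rightComul k D V t) = t := by
  induction t with
  | zero => simp
  | add a b ha hb => simp only [map_add, ha, hb]
  | tmul v x =>
    rw [rightComul_tmul k D v x _ _ _ (ℛ k x).eq]
    simp only [rightCounit, map_sum, LinearMap.comp_apply, LinearMap.lTensor_tmul,
      LinearMap.rTensor_tmul, LinearEquiv.coe_coe, TensorProduct.rid_tmul, TensorProduct.smul_tmul,
      ← TensorProduct.tmul_sum]
    rw [sum_counit_smul]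

theorem leftComul_counit (t : D ⊗[k] V) :
    leftCounit k D (D ⊗[k] V) (leftComul k D V t) = t := by
  induction t with
  | zero => simp
  | add a b ha hb => simp only [map_add, ha, hb]
  | tmul x v =>
    rw [leftComul_tmul k D v x _ _ _ (ℛ k x).eq]
    simp only [leftCounit, map_sum, LinearMap.comp_apply, LinearMap.rTensor_tmul,
      LinearEquiv.coe_coe, TensorProduct.lid_tmul, TensorProduct.smul_tmul',
      ← TensorProduct.sum_tmul]
    rw [sum_counit_smul]

theorem leftComul_map_counit (t : D ⊗[k] V) :
    (leftCounit k D V).lTensor D (leftComul k D V t) = t := by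
  induction t with
  | zero => simp
  | add a b ha hb => simp only [map_add, ha, hb]
  | tmul x v =>
    rw [leftComul_tmul k D v x _ _ _ (ℛ k x).eq]
    simp only [leftCounit, map_sum, LinearMap.comp_apply, LinearMap.rTensor_tmul,
      LinearMap.lTensor_tmul, LinearEquiv.coe_coe, TensorProduct.lid_tmul,
      ← TensorProduct.smul_tmul, ← TensorProduct.sum_tmul]
    rw [sum_counit_smul' k D]

theorem contraMul_unit (f : D →ₗ[k] V) :
    contraMul k D V (contraUnit k D (D →ₗ[k] V) f) = f := by
  ext x
  rw [contraMul_apply k D _ x _ _ _ (ℛ k x).eq]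
  conv_rhs => rw [← sum_counit_smul' k D x]
  simp [contraUnit]

theorem contraMul_map_unit (f : D →ₗ[k] V) :
    contraMul k D V (contraUnit k D V ∘ₗ f) = f := by
  ext x
  rw [contraMul_apply k D _ x _ _ _ (ℛ k x).eq]
  conv_rhs => rw [← sum_counit_smul (ℛ k x)]
  simp [contraUnit]

end

/-- The comonad `V ↦ V ⊗ D` on vector spaces, with counit `rightCounit` and comultiplication
`rightComul`. -/
def rightComonad : Comonad (ModuleCat.{u} k) where
  obj V := ModuleCat.of k (V ⊗[k] D)
  map f := ModuleCat.ofHom (f.hom.rTensor D)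
  map_id V := by ext : 1; exact LinearMap.rTensor_id _ _
  map_comp f g := by ext : 1; exact LinearMap.rTensor_comp _ _ _
  ε := { app := fun V => ModuleCat.ofHom (rightCounit k D V)
         naturality := fun V W f => by
          ext : 1
          apply TensorProduct.ext'
          intro v x
          simp [rightCounit] }
  δ := { app := fun V => ModuleCat.ofHom (rightComul k D V)
         naturality := fun V W f => by
          ext : 1
          apply TensorProduct.ext'
          intro v x
          simp [fun v => rightComul_tmul k D v x _ _ _ (ℛ k x).eq] }
  coassoc V := by
    ext : 1
    exact LinearMap.ext (rightComul_coassoc k D (V := V))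
  left_counit V := by
    ext : 1
    exact LinearMap.ext (rightComul_counit k D (V := V))
  right_counit V := by
    ext : 1
    exact LinearMap.ext (rightComul_map_counit k D (V := V))

/-- The comonad `V ↦ D ⊗ V` on vector spaces, with counit `leftCounit` and comultiplication
`leftComul`. -/
def leftComonad : Comonad (ModuleCat.{u} k) where
  obj V := ModuleCat.of k (D ⊗[k] V)
  map f := ModuleCat.ofHom (f.hom.lTensor D)
  map_id V := by ext : 1; exact LinearMap.lTensor_id _ _
  map_comp f g := by ext : 1; exact LinearMap.lTensor_comp _ _ _
  ε := { app := fun V => ModuleCat.ofHom (leftCounit k D V)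
         naturality := fun V W f => by
          ext : 1
          apply TensorProduct.ext'
          intro x v
          simp [leftCounit] }
  δ := { app := fun V => ModuleCat.ofHom (leftComul k D V)
         naturality := fun V W f => by
          ext : 1
          apply TensorProduct.ext'
          intro x v
          simp [fun v => leftComul_tmul k D v x _ _ _ (ℛ k x).eq] }
  coassoc V := by
    ext : 1
    exact LinearMap.ext (leftComul_coassoc k D (V := V))
  left_counit V := by
    ext : 1
    exact LinearMap.ext (leftComul_counit k D (V := V))
  right_counit V := by
    ext : 1
    exact LinearMap.ext (leftComul_map_counit k D (V := V))

/-- The monad `V ↦ Hom_k(D, V)` on vector spaces, with unit `contraUnit` and multiplication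
`contraMul`. -/
def contraMonad : Monad (ModuleCat.{u} k) where
  obj V := ModuleCat.of k (D →ₗ[k] V)
  map f := ModuleCat.ofHom (LinearMap.compRight k f.hom)
  map_id V := by ext; simp
  map_comp f g := by ext; simp
  η := { app := fun V => ModuleCat.ofHom (contraUnit k D V)
         naturality := fun V W f => by
          ext v x
          simp [contraUnit] }
  μ := { app := fun V => ModuleCat.ofHom (contraMul k D V)
         naturality := fun V W f => by
          ext g x
          refine (contraMul_apply k D (V := W) _ x _ _ _ (ℛ k x).eq).trans ?_
          refine Eq.trans ?_ (congrArg f.hom (contraMul_apply k D (V := V) g x _ _ _ (ℛ k x).eq)).symm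
          rw [map_sum]
          rfl }
  assoc V := by
    ext f : 2
    exact contraMul_assoc k D f
  left_unit V := by
    ext : 1
    exact LinearMap.ext (contraMul_unit k D (V := V))
  right_unit V := by
    ext : 1
    exact LinearMap.ext (contraMul_map_unit k D (V := V))

instance : (rightComonad k D).toFunctor.Additive where
  map_add {V W f g} := by
    ext : 1
    exact LinearMap.rTensor_add D f.hom g.hom

instance : (leftComonad k D).toFunctor.Additive where
  map_add {V W f g} := by
    ext : 1
    exact LinearMap.lTensor_add D f.hom g.hom

instance : (contraMonad k D).toFunctor.Additive where
  map_add {V W f g} := by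
    ext : 1
    exact LinearMap.ext fun (h : D →ₗ[k] V) => LinearMap.add_comp h g.hom f.hom

/-- Right `D`-comodules: vector spaces `N` with a coassociative and counital coaction
`N → N ⊗ D`. -/
abbrev RightComod : Type (u + 1) := (rightComonad k D).Coalgebra

/-- Left `D`-comodules: vector spaces `M` with a coassociative and counital coaction
`M → D ⊗ M`. -/
abbrev LeftComod : Type (u + 1) := (leftComonad k D).Coalgebra

/-- Left `D`-contramodules: vector spaces `P` with a contraassociative and contraunital
contraaction `Hom_k(D, P) → P`. -/
abbrev LeftContra : Type (u + 1) := (contraMonad k D).Algebra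

instance : Abelian (RightComod k D) := abelianCoalgebra _

instance : Abelian (LeftContra k D) := abelianAlgebra _

instance : EnoughProjectives (LeftContra k D) where
  presentation P := by
    have : Projective ((contraMonad k D).forget.obj P) :=
      ModuleCat.projective_of_free (Module.Free.chooseBasis k P.A)
    have : PreservesFiniteColimits (contraMonad k D).toFunctor := (exact_of_additive _).2
    have : PreservesFiniteColimits (contraMonad k D).forget := ⟨fun J _ _ => inferInstance⟩
    have : (contraMonad k D).forget.PreservesEpimorphisms := inferInstance
    have h : IsSplitEpi ((contraMonad k D).forget.map ((contraMonad k D).adj.counit.app P)) :=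
      ⟨⟨⟨_, (contraMonad k D).adj.right_triangle_components P⟩⟩⟩
    exact ⟨{
      p := (contraMonad k D).free.obj ((contraMonad k D).forget.obj P)
      projective := (contraMonad k D).adj.map_projective _ inferInstance
      f := (contraMonad k D).adj.counit.app P
      epi := (contraMonad k D).forget.epi_of_epi_map inferInstance }⟩

variable {k D}

/-- The coaction `N → N ⊗ D` of a right comodule. -/
def RightComod.coact (N : RightComod k D) : N.A →ₗ[k] N.A ⊗[k] D := N.a.hom

/-- The contraaction `Hom_k(D, P) → P` of a left contramodule. -/
def LeftContra.contraact (P : LeftContra k D) : (D →ₗ[k] P.A) →ₗ[k] P.A := P.a.hom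

/-! ### Finiteness conditions -/

/-- A right comodule is finitely cogenerated if it embeds into a cofree comodule `V ⊗ D` with
a finite-dimensional space of cogenerators `V`. -/
def RightComod.FinCogenerated (L : RightComod k D) : Prop :=
  ∃ (V : ModuleCat.{u} k) (_ : Module.Finite k V) (i : L ⟶ (rightComonad k D).cofree.obj V),
    Function.Injective i.f.hom

/-- A right comodule is finitely copresented if it is the kernel of a morphism of finitely
cogenerated cofree comodules. -/
def RightComod.FinCopresented (L : RightComod k D) : Prop :=
  ∃ (V W : ModuleCat.{u} k) (_ : Module.Finite k V) (_ : Module.Finite k W)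
    (i : L ⟶ (rightComonad k D).cofree.obj V)
    (f : (rightComonad k D).cofree.obj V ⟶ (rightComonad k D).cofree.obj W),
    Function.Injective i.f.hom ∧ Function.Exact i.f.hom f.f.hom

/-- A left comodule is finitely cogenerated if it embeds into a cofree comodule `D ⊗ V` with
a finite-dimensional space of cogenerators `V`. -/
def LeftComod.FinCogenerated (L : LeftComod k D) : Prop :=
  ∃ (V : ModuleCat.{u} k) (_ : Module.Finite k V) (i : L ⟶ (leftComonad k D).cofree.obj V),
    Function.Injective i.f.hom

variable (k D)

/-- `D` is right cocoherent: any finitely cogenerated quotient comodule of a finitely copresented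
right `D`-comodule is finitely copresented. -/
def IsRightCocoherent : Prop :=
  ∀ (L M : RightComod k D) (p : L ⟶ M), Function.Surjective p.f.hom →
    L.FinCopresented → M.FinCogenerated → M.FinCopresented

/-- `D` is left co-Noetherian: any quotient comodule of a finitely cogenerated left `D`-comodule
is finitely cogenerated. -/
def IsLeftCoNoetherian : Prop :=
  ∀ (L M : LeftComod k D) (p : L ⟶ M), Function.Surjective p.f.hom →
    L.FinCogenerated → M.FinCogenerated

variable {k D}

/-! ### Contratensor product and its derived functor -/

/-- The difference of the two maps `N ⊗ Hom_k(D, P) → N ⊗ P`: the one induced by the contraaction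
of `P`, and `n ⊗ f ↦ n₍₀₎ ⊗ f n₍₁₎`. -/
def contraDiff (N : RightComod k D) (P : LeftContra k D) :
    N.A ⊗[k] (D →ₗ[k] P.A) →ₗ[k] N.A ⊗[k] P.A :=
  P.contraact.lTensor N.A -
    (TensorProduct.lift (LinearMap.id : (D →ₗ[k] P.A) →ₗ[k] (D →ₗ[k] P.A)).flip).lTensor N.A ∘ₗ
      (TensorProduct.assoc k N.A D (D →ₗ[k] P.A)).toLinearMap ∘ₗ
      N.coact.rTensor (D →ₗ[k] P.A)

theorem contraDiff_naturality {N N' : RightComod k D} {P P' : LeftContra k D}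
    (f : N ⟶ N') (g : P ⟶ P') :
    TensorProduct.map f.f.hom g.f.hom ∘ₗ contraDiff N P =
      contraDiff N' P' ∘ₗ TensorProduct.map f.f.hom (LinearMap.compRight k g.f.hom) := by
  apply TensorProduct.ext'
  intro n h
  have h1 : g.f.hom (P.contraact h) = P'.contraact (g.f.hom ∘ₗ h) :=
    (LinearMap.congr_fun (congrArg ModuleCat.Hom.hom g.h) h).symm
  have h2 : N'.coact (f.f.hom n) = f.f.hom.rTensor D (N.coact n) :=
    (LinearMap.congr_fun (congrArg ModuleCat.Hom.hom f.h) n).symm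
  simp only [contraDiff, LinearMap.comp_apply, LinearMap.sub_apply, LinearMap.lTensor_tmul,
    LinearMap.rTensor_tmul, map_sub, TensorProduct.map_tmul, h1, h2]
  congr 1
  generalize N.coact n = z
  induction z with
  | zero => simp
  | add a b ha hb => simp only [TensorProduct.add_tmul, map_add, ha, hb]
  | tmul a b => simp

/-- The contratensor product `N ⊙_D P` of a right comodule and a left contramodule. -/
def contratensorObj (N : RightComod k D) (P : LeftContra k D) : ModuleCat.{u} k :=
  ModuleCat.of k ((N.A ⊗[k] P.A) ⧸ LinearMap.range (contraDiff N P))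

/-- The map `f ⊙_D g`. -/
def contratensorMap {N N' : RightComod k D} {P P' : LeftContra k D} (f : N ⟶ N') (g : P ⟶ P') :
    contratensorObj N P ⟶ contratensorObj N' P' :=
  ModuleCat.ofHom (Submodule.mapQ _ _ (TensorProduct.map f.f.hom g.f.hom) (by
    rintro _ ⟨t, rfl⟩
    exact ⟨_, (LinearMap.congr_fun (contraDiff_naturality f g) t).symm⟩))

theorem contratensorMap_ext {N : RightComod k D} {P : LeftContra k D} {X : ModuleCat.{u} k}
    {f g : contratensorObj N P ⟶ X}
    (h : ∀ (n : N.A) (p : P.A), f.hom (Submodule.Quotient.mk (n ⊗ₜ[k] p)) =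
      g.hom (Submodule.Quotient.mk (n ⊗ₜ[k] p))) : f = g := by
  ext : 1
  apply Submodule.linearMap_qext
  exact TensorProduct.ext' h

theorem contratensorMap_mk {N N' : RightComod k D} {P P' : LeftContra k D} (f : N ⟶ N')
    (g : P ⟶ P') (n : N.A) (p : P.A) :
    (contratensorMap f g).hom (Submodule.Quotient.mk (n ⊗ₜ[k] p)) =
      Submodule.Quotient.mk (f.f.hom n ⊗ₜ[k] g.f.hom p) := rfl

theorem contratensorMap_comp {N N' N'' : RightComod k D} {P P' P'' : LeftContra k D} (f : N ⟶ N')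
    (g : P ⟶ P') (f' : N' ⟶ N'') (g' : P' ⟶ P'') :
    contratensorMap (f ≫ f') (g ≫ g') = contratensorMap f g ≫ contratensorMap f' g' :=
  contratensorMap_ext fun _ _ => rfl

variable (k D)

/-- The contratensor product as a bifunctor. -/
def contratensor : RightComod k D ⥤ LeftContra k D ⥤ ModuleCat.{u} k where
  obj N :=
    { obj := fun P => contratensorObj N P
      map := fun g => contratensorMap (𝟙 N) g
      map_id := fun _ => contratensorMap_ext fun _ _ => rfl
      map_comp := fun _ _ => contratensorMap_ext fun _ _ => rfl }
  map f :=
    { app := fun P => contratensorMap f (𝟙 P)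
      naturality := fun _ _ _ => contratensorMap_ext fun _ _ => rfl }
  map_id _ := by
    ext P : 2
    exact contratensorMap_ext fun _ _ => rfl
  map_comp _ _ := by
    ext P : 2
    exact contratensorMap_ext fun _ _ => rfl

instance : (contratensor k D).Additive where
  map_add {N N' f g} := by
    ext P : 2
    refine contratensorMap_ext fun n p => ?_
    exact congrArg Submodule.Quotient.mk (TensorProduct.add_tmul (f.f.hom n) (g.f.hom n) p)

instance (N : RightComod k D) : ((contratensor k D).obj N).Additive where
  map_add {P P' f g} := by
    refine contratensorMap_ext fun n p => ?_
    exact congrArg Submodule.Quotient.mk (TensorProduct.tmul_add n (f.f.hom p) (g.f.hom p))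

variable {k D}

/-- `Ctrtor^D_n(N, P) = H^{-n}(N ⊙_D F)` for a complex of right comodules `N` and a left
contramodule `P`, where `F` is a projective resolution of `P` and `N ⊙_D F` is the total complex
formed with direct sums along the diagonals. -/
def ctrtor (N : CochainComplex (RightComod k D) ℤ) (P : LeftContra k D) (n : ℤ) :
    ModuleCat.{u} k :=
  (HomologicalComplex.mapBifunctor N (projectiveResolution P).cochainComplex
    (contratensor k D) (ComplexShape.up ℤ)).homology (-n)

/-! ### Finite complexes and dimensions -/

/-- A complex is finite if only finitely many of its terms are nonzero. -/
def IsFiniteComplex (N : CochainComplex (RightComod k D) ℤ) : Prop :=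
  ∃ a b : ℤ, N.IsStrictlyGE a ∧ N.IsStrictlyLE b

/-- The contraflat dimension of `N` is at most `d`. -/
def ContraflatDimLE (N : CochainComplex (RightComod k D) ℤ) (d : ℤ) : Prop :=
  ∀ (P : LeftContra k D) (n : ℤ), d < n → IsZero (ctrtor N P n)

instance : HasDerivedCategory.{u + 1} (RightComod k D) := HasDerivedCategory.standard _

/-- A finite complex of right comodules as an object of the bounded derived category. -/
def toBounded (N : CochainComplex (RightComod k D) ℤ) (hN : IsFiniteComplex N) :
    DerivedCategory.Bounded (RightComod k D) :=
  ⟨DerivedCategory.Q.obj N, by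
    obtain ⟨a, b, _, _⟩ := hN
    exact ⟨⟨a, inferInstanceAs ((DerivedCategory.Q.obj N).IsGE a)⟩,
      ⟨b, inferInstanceAs ((DerivedCategory.Q.obj N).IsLE b)⟩⟩⟩

/-- A right comodule, placed in degree `0`, as an object of the bounded derived category. -/
def singleBounded (M : RightComod k D) : DerivedCategory.Bounded (RightComod k D) :=
  ⟨(DerivedCategory.singleFunctor _ 0).obj M,
    ⟨0, inferInstanceAs (DerivedCategory.IsGE _ 0)⟩,
    ⟨0, inferInstanceAs (DerivedCategory.IsLE _ 0)⟩⟩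

/-- The projective dimension of the finite complex `N` is at most `d`:
`Hom(N, M[n]) = 0` in the bounded derived category for all right comodules `M` and all `n > d`. -/
def ProjDimLE (N : CochainComplex (RightComod k D) ℤ) (hN : IsFiniteComplex N) (d : ℤ) : Prop :=
  ∀ (M : RightComod k D) (n : ℤ), d < n →
    ∀ f : toBounded N hN ⟶ (singleBounded M)⟦n⟧, f = 0

end

end ComodContra

namespace ComodContra

noncomputable section

/-! ### Cocycles with values in an injective resolution -/

section

open CochainComplex HomComplex

/-! The proof rests on a duality. For a finite-dimensional `V`, the dual of the cofree comodule `J =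
V ⊗ D` is the free contramodule on the dual of `V`, and functionals on `N ⊙_D J*` are the same as
comodule maps `N → J` (`FinCofree.exists_evalFunctional_eq`). If all `J i` are of this kind and `J`
resolves a comodule `M`, then functionals on `N ⊙_D J*` killing boundaries in degree `-n` are, up to
signs, the `n`-cocycles of the complex of maps from `N` to `J`. As `J` is an injective resolution,
the vanishing of `Hom(N, M[n])` makes each such cocycle a coboundary, and a coboundary kills every
cycle (`sum_functional_eq_zero`).

A general projective resolution `F` does not consist of such duals, so the problem is reduced to
them one cycle at a time. Suppose that a cycle `x` of degree `-n` in `N ⊙_D F`, with `n > d`, is not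
a boundary, and choose a functional `Λ` with `Λ x ≠ 0` that kills all boundaries. The cycle has
finitely many components. The co-Noetherian condition lifts it to a cycle of `N ⊙_D J*` for a
complex `J` of finitely cogenerated cofree comodules with a map `J* → F`
(`IsLeftCoNoetherian.exists_lift_cycle`). The complex `J` need not be exact. Cocoherence, together
with exactness of `F` and projectivity of the duals, factors `J* → F` through `J'*` with `J'` exact
in positive degrees (`IsRightCocoherent.exists_factor_exact`). The pullback of `Λ` to `N ⊙_D J'*`
then vanishes on the image of the lifted cycle, so `Λ x = 0`, a contradiction. -/

theorem mem_coboundaries_of_hom_eq_zero {C : Type*} [Category* C] [Abelian C]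
    [HasDerivedCategory C] {M : C} (R : InjectiveResolution M) (K : CochainComplex C ℤ) (n : ℤ)
    (h : ∀ f : DerivedCategory.Q.obj K ⟶ ((DerivedCategory.singleFunctor C 0).obj M)⟦n⟧, f = 0)
    (z : Cocycle K R.cochainComplex n) : z ∈ coboundaries K R.cochainComplex n := by
  have : R.cochainComplex.IsKInjective := isKInjective_of_injective _ 0
  rw [← CohomologyClass.toHom_mk_eq_zero_iff, CohomologyClass.toHom_mk]
  -- Into a K-injective complex, homotopy classes of maps agree with maps in the derived category,
  -- so it suffices to kill the class there.
  apply (IsKInjective.Qh_map_bijective _ _).injective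
  rw [Functor.map_zero]
  have hQ : DerivedCategory.Q.map (Cocycle.equivHomShift.symm z) = 0 := by
    let e : DerivedCategory.Q.obj ((CochainComplex.singleFunctor C 0).obj M) ≅
        DerivedCategory.Q.obj R.cochainComplex :=
      have : IsIso (DerivedCategory.Q.map R.ι') :=
        Localization.inverts _ (HomologicalComplex.quasiIso C (ComplexShape.up ℤ)) _
          ((HomologicalComplex.mem_quasiIso_iff _).2 inferInstance)
      asIso (DerivedCategory.Q.map R.ι')
    rw [← cancel_mono ((DerivedCategory.Q.commShiftIso n).hom.app R.cochainComplex),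
      ← cancel_mono (e.inv⟦n⟧'), zero_comp, zero_comp]
    exact h _
  exact hQ

end

/-- The bounded derived category is a full subcategory of the derived category, so the hypothesis on
bounded maps applies to every map out of `N` in the latter. -/
theorem exists_cochain_of_projDimLE {k : Type u} [Field k] {D : Type u} [AddCommGroup D]
    [Module k D] [Coalgebra k D] {N : CochainComplex (RightComod k D) ℤ} {hN : IsFiniteComplex N}
    {d : ℤ} (hd : ProjDimLE N hN d) {M : RightComod k D} (R : InjectiveResolution M) {n m : ℤ}
    (hm : m + 1 = n) (hn : d < n) (z : CochainComplex.HomComplex.Cocycle N R.cochainComplex n) :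
    ∃ α : CochainComplex.HomComplex.Cochain N R.cochainComplex m,
      CochainComplex.HomComplex.δ m n α = z.1 := by
  rw [← CochainComplex.HomComplex.mem_coboundaries_iff z m hm]
  refine mem_coboundaries_of_hom_eq_zero R N n (fun f => ?_) z
  let ι := DerivedCategory.Bounded.ι (C := RightComod k D)
  obtain ⟨g, hg⟩ := ι.map_surjective (X := toBounded N hN)
    (f ≫ (ι.commShiftIso n).inv.app (singleBounded M))
  rw [hd M n hn g, Functor.map_zero] at hg
  exact (cancel_mono ((ι.commShiftIso n).inv.app (singleBounded M))).1 (hg.symm.trans zero_comp.symm)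

/-! ### The contramodule dual to a comodule -/

section

open Coalgebra

variable {k : Type u} [Field k] {D : Type u} [AddCommGroup D] [Module k D] [Coalgebra k D]

theorem RightComod.counit_coact (N : RightComod k D) (n : N.A) :
    rightCounit k D N.A (N.coact n) = n :=
  LinearMap.congr_fun (congrArg ModuleCat.Hom.hom N.counit) n

theorem RightComod.coassoc_coact (N : RightComod k D) (n : N.A) :
    rightComul k D N.A (N.coact n) = N.coact.rTensor D (N.coact n) :=
  LinearMap.congr_fun (congrArg ModuleCat.Hom.hom N.coassoc) n

theorem RightComod.coact_hom {N N' : RightComod k D} (f : N ⟶ N') (n : N.A) :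
    N'.coact (f.f.hom n) = f.f.hom.rTensor D (N.coact n) :=
  (LinearMap.congr_fun (congrArg ModuleCat.Hom.hom f.h) n).symm

/-- The contraaction `f ↦ (n ↦ f n₍₁₎ n₍₀₎)` on the dual space of a right comodule. -/
def dualContraact (N : RightComod k D) : (D →ₗ[k] (N.A →ₗ[k] k)) →ₗ[k] (N.A →ₗ[k] k) where
  toFun f := TensorProduct.lift f.flip ∘ₗ N.coact
  map_add' f g := by
    rw [← LinearMap.add_comp]; congr 1; ext; simp
  map_smul' c f := by
    rw [RingHom.id_apply, ← LinearMap.smul_comp]; congr 1; ext; simp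

theorem dualContraact_apply (N : RightComod k D) (f : D →ₗ[k] (N.A →ₗ[k] k)) (n : N.A) :
    dualContraact N f n = TensorProduct.lift f.flip (N.coact n) := rfl

/-- The contramodule `Hom_k(N, k)` dual to a right comodule `N`. -/
def dualContra (N : RightComod k D) : LeftContra k D where
  A := ModuleCat.of k (N.A →ₗ[k] k)
  a := ModuleCat.ofHom (dualContraact N)
  unit := by
    ext φ : 2
    refine LinearMap.ext fun n => ?_
    have h : TensorProduct.lift (contraUnit k D (N.A →ₗ[k] k) φ).flip =
        φ ∘ₗ rightCounit k D N.A := by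
      apply TensorProduct.ext'
      intro n x
      simp [rightCounit, contraUnit]
    refine (LinearMap.congr_fun h (N.coact n)).trans ?_
    exact congrArg (DFunLike.coe (F := N.A →ₗ[k] k) φ) (N.counit_coact n)
  assoc := by
    ext f : 2
    refine LinearMap.ext fun n => ?_
    change D →ₗ[k] (D →ₗ[k] (N.A →ₗ[k] k)) at f
    -- Both iterated contraactions of `f` are `Ψ` composed with an iterated coaction, so
    -- contraassociativity is `Ψ` applied to the coassociativity of `N`.
    let Ψ : (N.A ⊗[k] D) ⊗[k] D →ₗ[k] k :=
      TensorProduct.lift (((TensorProduct.lift.equiv (.id k) N.A D k).toLinearMap ∘ₗ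
        LinearMap.lflip.toLinearMap ∘ₗ f).flip)
    have hΨ (n : N.A) (a b : D) : Ψ ((n ⊗ₜ a) ⊗ₜ b) = f b a n := rfl
    have h1 : TensorProduct.lift (contraMul k D _ f).flip = Ψ ∘ₗ rightComul k D N.A := by
      apply TensorProduct.ext'
      intro n x
      simp [rightComul_tmul k D n x _ _ _ (ℛ k x).eq, hΨ,
        contraMul_apply k D f x _ _ _ (ℛ k x).eq]
    have h2 : TensorProduct.lift (dualContraact N ∘ₗ f).flip = Ψ ∘ₗ N.coact.rTensor D := by
      apply TensorProduct.ext'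
      intro n x
      simp only [TensorProduct.lift.tmul, LinearMap.flip_apply, LinearMap.comp_apply,
        dualContraact_apply, LinearMap.rTensor_tmul]
      generalize N.coact n = z
      induction z with
      | zero => simp
      | add a b ha hb => simp only [TensorProduct.add_tmul, map_add, ha, hb]
      | tmul a b => simp [hΨ]
    refine (LinearMap.congr_fun h1 (N.coact n)).trans ?_
    refine Eq.trans ?_ (LinearMap.congr_fun h2 (N.coact n)).symm
    exact congrArg Ψ (N.coassoc_coact n)

/-- The contramodule map dual to a map of comodules. -/
def dualMap {N N' : RightComod k D} (f : N ⟶ N') : dualContra N' ⟶ dualContra N where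
  f := ModuleCat.ofHom f.f.hom.dualMap
  h := by
    ext φ : 2
    refine LinearMap.ext fun n => ?_
    change D →ₗ[k] (N'.A →ₗ[k] k) at φ
    change TensorProduct.lift (f.f.hom.dualMap ∘ₗ φ).flip (N.coact n) =
      TensorProduct.lift φ.flip (N'.coact (f.f.hom n))
    rw [RightComod.coact_hom, ← LinearMap.comp_apply]
    have h : TensorProduct.lift (f.f.hom.dualMap ∘ₗ φ).flip =
        TensorProduct.lift φ.flip ∘ₗ f.f.hom.rTensor D :=
      TensorProduct.ext' fun n x => by simp
    exact LinearMap.congr_fun h (N.coact n)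

theorem dualMap_id (N : RightComod k D) : dualMap (𝟙 N) = 𝟙 _ := rfl

theorem dualMap_comp {N N' N'' : RightComod k D} (f : N ⟶ N') (g : N' ⟶ N'') :
    dualMap (f ≫ g) = dualMap g ≫ dualMap f := rfl

theorem LeftContra.hom_ext {P P' : LeftContra k D} {f g : P ⟶ P'}
    (h : ∀ p, f.f.hom p = g.f.hom p) : f = g := by
  ext : 2
  exact LinearMap.ext h

theorem RightComod.hom_ext {N N' : RightComod k D} {f g : N ⟶ N'}
    (h : ∀ n, f.f.hom n = g.f.hom n) : f = g := by
  ext : 2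
  exact LinearMap.ext h

/-- Functionals separate the points of a vector space. -/
theorem dualMap_injective {N N' : RightComod k D} {f g : N ⟶ N'} (h : dualMap f = dualMap g) :
    f = g := by
  refine RightComod.hom_ext fun n => ?_
  rw [← sub_eq_zero, ← Module.forall_dual_apply_eq_zero_iff k]
  intro φ
  have := LinearMap.congr_fun (congrArg (fun t => t.f.hom φ) h : f.f.hom.dualMap φ =
    g.f.hom.dualMap φ) n
  simpa [sub_eq_zero] using this

theorem dualMap_add {N N' : RightComod k D} (f g : N ⟶ N') :
    dualMap (f + g) = dualMap f + dualMap g := by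
  refine LeftContra.hom_ext fun φ => LinearMap.ext fun n => ?_
  exact LinearMap.map_add φ (f.f.hom n) (g.f.hom n)

theorem dualMap_zero (N N' : RightComod k D) : dualMap (0 : N ⟶ N') = 0 := by
  refine LeftContra.hom_ext fun φ => LinearMap.ext fun n => ?_
  exact LinearMap.map_zero φ

/-! ### The dual of a cofree comodule -/

/-- The contramodule dual to the cofree comodule `V ⊗ D` is free on the dual of `V`. -/
def dualCofreeIso (V : ModuleCat.{u} k) :
    (contraMonad k D).free.obj (ModuleCat.of k (V →ₗ[k] k)) ≅
      dualContra ((rightComonad k D).cofree.obj V) :=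
  Monad.Algebra.isoMk (LinearEquiv.toModuleIso
    ((LinearMap.lflip (R₀ := k)).trans (TensorProduct.lift.equiv (.id k) V D k))) (by
      ext f : 2
      change D →ₗ[k] (D →ₗ[k] (V →ₗ[k] k)) at f
      refine TensorProduct.ext' (R := k) (M := V) (N := D) fun v x => ?_
      change TensorProduct.lift _ (rightComul k D V (v ⊗ₜ x)) =
        DFunLike.coe (F := V →ₗ[k] k) (contraMul k D (V →ₗ[k] k) f x) v
      rw [rightComul_tmul k D v x _ _ _ (ℛ k x).eq, contraMul_apply k D f x _ _ _ (ℛ k x).eq,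
        map_sum, LinearMap.sum_apply]
      rfl)

theorem dualCofreeIso_hom_apply (V : ModuleCat.{u} k) (f : D →ₗ[k] (V →ₗ[k] k)) (v : V) (x : D) :
    DFunLike.coe (F := V ⊗[k] D →ₗ[k] k) ((dualCofreeIso V).hom.f.hom f) (v ⊗ₜ x) = f x v := rfl

end

/-! ### Universal properties of free contramodules and cofree comodules -/

section

variable {k : Type u} [Field k] {D : Type u} [AddCommGroup D] [Module k D] [Coalgebra k D]

/-- The map from a free contramodule extending a linear map. -/
def freeLift {W : ModuleCat.{u} k} {P : LeftContra k D} (u : W →ₗ[k] P.A) :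
    (contraMonad k D).free.obj W ⟶ P :=
  ((contraMonad k D).adj.homEquiv W P).symm (ModuleCat.ofHom u)

theorem freeLift_unit {W : ModuleCat.{u} k} {P : LeftContra k D} (u : W →ₗ[k] P.A) (w : W) :
    (freeLift u).f.hom (contraUnit k D W w) = u w :=
  LinearMap.congr_fun (congrArg ModuleCat.Hom.hom
    (((contraMonad k D).adj.homEquiv W P).apply_symm_apply (ModuleCat.ofHom u))) w

theorem free_hom_ext {W : ModuleCat.{u} k} {P : LeftContra k D}
    {f g : (contraMonad k D).free.obj W ⟶ P}
    (h : ∀ w : W, f.f.hom (contraUnit k D W w) = g.f.hom (contraUnit k D W w)) : f = g := by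
  apply ((contraMonad k D).adj.homEquiv W P).injective
  ext w
  exact h w

/-- The map to a cofree coalgebra over a comonad corresponding to a morphism of the base
category. -/
def _root_.CategoryTheory.Comonad.cofreeLift {C : Type*} [Category* C] (G : Comonad C)
    {N : G.Coalgebra} {V : C} (s : N.A ⟶ V) : N ⟶ G.cofree.obj V where
  f := N.a ≫ G.map s
  h := by
    change N.a ≫ G.map (N.a ≫ G.map s) = (N.a ≫ G.map s) ≫ G.δ.app V
    simp [← Comonad.Coalgebra.coassoc_assoc]

theorem _root_.CategoryTheory.Comonad.cofreeLift_counit {C : Type*} [Category* C] (G : Comonad C)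
    {N : G.Coalgebra} {V : C} (s : N.A ⟶ V) : (G.cofreeLift s).f ≫ G.ε.app V = s := by
  change (N.a ≫ G.map s) ≫ G.ε.app V = s
  simp [Comonad.Coalgebra.counit_assoc]

theorem _root_.CategoryTheory.Comonad.cofree_hom_ext {C : Type*} [Category* C] (G : Comonad C)
    {N : G.Coalgebra} {V : C} {f g : N ⟶ G.cofree.obj V}
    (h : f.f ≫ G.ε.app V = g.f ≫ G.ε.app V) : f = g := by
  apply (G.adj.homEquiv N V).symm.injective
  simp only [Comonad.adj, Adjunction.mkOfHomEquiv_homEquiv]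
  exact h

/-- The map to a cofree comodule extending a linear map. -/
def cofreeLift {N : RightComod k D} {V : ModuleCat.{u} k} (s : N.A →ₗ[k] V) :
    N ⟶ (rightComonad k D).cofree.obj V :=
  (rightComonad k D).cofreeLift (ModuleCat.ofHom s)

theorem cofreeLift_counit {N : RightComod k D} {V : ModuleCat.{u} k} (s : N.A →ₗ[k] V)
    (n : N.A) : rightCounit k D V ((cofreeLift s).f.hom n) = s n :=
  LinearMap.congr_fun (congrArg ModuleCat.Hom.hom
    ((rightComonad k D).cofreeLift_counit (ModuleCat.ofHom s))) n

/-! ### Finitely cogenerated cofree comodules -/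

/-- Isomorphic to a cofree comodule with a finite-dimensional space of cogenerators. -/
def FinCofree (J : RightComod k D) : Prop :=
  ∃ (V : ModuleCat.{u} k) (_ : Module.Finite k V),
    Nonempty (J ≅ (rightComonad k D).cofree.obj V)

instance (V : ModuleCat.{u} k) : Injective ((rightComonad k D).cofree.obj V) := by
  have : Injective V := by
    have := Module.injective_of_isSemisimpleRing k V
    exact Module.injective_object_of_injective_module k V
  have : PreservesFiniteLimits (rightComonad k D).toFunctor := (exact_of_additive _).1
  have : PreservesFiniteLimits (rightComonad k D).forget := ⟨fun J _ _ => inferInstance⟩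
  -- The cofree functor is right adjoint to an exact functor, hence preserves injectives.
  exact (rightComonad k D).adj.map_injective _ inferInstance

theorem FinCofree.injective {J : RightComod k D} (hJ : FinCofree J) : Injective J := by
  obtain ⟨V, _, ⟨e⟩⟩ := hJ
  exact Injective.of_iso e.symm inferInstance

theorem FinCofree.projective_dual {J : RightComod k D} (hJ : FinCofree J) :
    Projective (dualContra J) := by
  obtain ⟨V, _, ⟨e⟩⟩ := hJ
  have : Projective (ModuleCat.of k (V →ₗ[k] k)) :=
    ModuleCat.projective_of_free (Module.Free.chooseBasis k _)
  have : PreservesFiniteColimits (contraMonad k D).toFunctor := (exact_of_additive _).2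
  have : PreservesFiniteColimits (contraMonad k D).forget := ⟨fun J _ _ => inferInstance⟩
  have : (contraMonad k D).forget.PreservesEpimorphisms := inferInstance
  have : Projective ((contraMonad k D).free.obj (ModuleCat.of k (V →ₗ[k] k))) :=
    (contraMonad k D).adj.map_projective _ inferInstance
  exact Projective.of_iso (dualCofreeIso V ≪≫ ⟨dualMap e.hom, dualMap e.inv,
    by rw [← dualMap_comp, e.inv_hom_id]; rfl, by rw [← dualMap_comp, e.hom_inv_id]; rfl⟩) this

instance : (rightComonad k D).cofree.Additive where
  map_add {V W f g} := by
    ext : 1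
    exact (rightComonad k D).toFunctor.map_add

theorem FinCofree.biprod {J J' : RightComod k D} (hJ : FinCofree J) (hJ' : FinCofree J') :
    FinCofree (J ⊞ J') := by
  obtain ⟨V, _, ⟨e⟩⟩ := hJ
  obtain ⟨V', _, ⟨e'⟩⟩ := hJ'
  have : Module.Finite k (V ⊞ V' : ModuleCat.{u} k) :=
    Module.Finite.equiv (ModuleCat.biprodIsoProd V V').toLinearEquiv.symm
  have : PreservesBinaryBiproducts (rightComonad k D).cofree :=
    preservesBinaryBiproducts_of_preservesBiproducts _
  exact ⟨V ⊞ V', ‹_›, ⟨biprod.mapIso e e' ≪≫ ((rightComonad k D).cofree.mapBiprod V V').symm⟩⟩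

/-! ### Functionals on the contratensor product -/

/-- The bilinear map `(n, p) ↦ n ⊗ p` to the contratensor product. -/
def ctMk (N : RightComod k D) (P : LeftContra k D) : N.A →ₗ[k] P.A →ₗ[k] contratensorObj N P :=
  TensorProduct.curry (Submodule.mkQ (LinearMap.range (contraDiff N P)))

theorem contraDiff_tmul {X : Type*} [AddCommGroup X] [Module k X] {N : RightComod k D}
    {P : LeftContra k D} (B : N.A →ₗ[k] P.A →ₗ[k] X) (n : N.A) (h : D →ₗ[k] P.A) :
    TensorProduct.lift B (contraDiff N P (n ⊗ₜ h)) =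
      B n (P.contraact h) - TensorProduct.lift (B.compl₂ h) (N.coact n) := by
  simp only [contraDiff, LinearMap.sub_apply, map_sub, LinearMap.lTensor_tmul,
    TensorProduct.lift.tmul, LinearMap.comp_apply, LinearMap.rTensor_tmul]
  congr 1
  generalize N.coact n = z
  induction z with
  | zero => simp
  | add a b ha hb => simp only [TensorProduct.add_tmul, map_add, ha, hb]
  | tmul a b => simp

theorem ctMk_contraact {N : RightComod k D} {P : LeftContra k D} (n : N.A) (h : D →ₗ[k] P.A) :
    ctMk N P n (P.contraact h) = TensorProduct.lift ((ctMk N P).compl₂ h) (N.coact n) := by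
  have h' : TensorProduct.lift (ctMk N P) = (LinearMap.range (contraDiff N P)).mkQ :=
    TensorProduct.ext' fun _ _ => rfl
  rw [← sub_eq_zero, ← contraDiff_tmul, h']
  exact (Submodule.Quotient.mk_eq_zero _).2 ⟨_, rfl⟩

/-- The linear map from the contratensor product induced by a balanced bilinear map. -/
def ctLift {X : Type*} [AddCommGroup X] [Module k X] {N : RightComod k D} {P : LeftContra k D}
    (B : N.A →ₗ[k] P.A →ₗ[k] X)
    (hB : ∀ n h, B n (P.contraact h) = TensorProduct.lift (B.compl₂ h) (N.coact n)) :
    contratensorObj N P →ₗ[k] X :=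
  Submodule.liftQ _ (TensorProduct.lift B) (by
    rw [LinearMap.range_le_ker_iff]
    refine TensorProduct.ext' fun n h => ?_
    rw [LinearMap.comp_apply, contraDiff_tmul, hB, sub_self, LinearMap.zero_apply])

theorem ct_hom_ext {X : Type*} [AddCommGroup X] [Module k X] {N : RightComod k D}
    {P : LeftContra k D} {f g : contratensorObj N P →ₗ[k] X}
    (h : ∀ n p, f (ctMk N P n p) = g (ctMk N P n p)) : f = g :=
  Submodule.linearMap_qext _ (TensorProduct.ext' h)

/-- The contramodule map `P → Hom_k(N, k)` corresponding to a functional on `N ⊙_D P`. -/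
def toDual {N : RightComod k D} {P : LeftContra k D} (ψ : contratensorObj N P →ₗ[k] k) :
    P ⟶ dualContra N where
  f := ModuleCat.ofHom ((ctMk N P).compr₂ ψ).flip
  h := by
    ext h : 2
    refine LinearMap.ext fun n => ?_
    change D →ₗ[k] P.A at h
    refine Eq.trans ?_ (congrArg ψ (ctMk_contraact n h)).symm
    rw [← LinearMap.comp_apply, TensorProduct.lift_compr₂ ψ |>.symm]
    rfl

theorem dualCofreeIso_unit (V : ModuleCat.{u} k) (ξ : V →ₗ[k] k) (z : V ⊗[k] D) :
    DFunLike.coe (F := V ⊗[k] D →ₗ[k] k)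
      ((dualCofreeIso V).hom.f.hom (contraUnit k D (V →ₗ[k] k) ξ)) z =
        ξ (rightCounit k D V z) := by
  refine LinearMap.congr_fun (g := ξ ∘ₗ rightCounit k D V) (TensorProduct.ext' fun v x => ?_) z
  rw [dualCofreeIso_hom_apply]
  simp [contraUnit, rightCounit]

/-- With `J = V ⊗ D`, contramodule maps `J* → N*` are linear maps `V* → N*` by freeness, hence
linear maps `N → V**`; comodule maps `N → J` are linear maps `N → V`. Finite-dimensionality enters
through `V = V**`. -/
theorem FinCofree.exists_dualMap_eq {N J : RightComod k D} (hJ : FinCofree J)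
    (t : dualContra J ⟶ dualContra N) : ∃ φ : N ⟶ J, dualMap φ = t := by
  obtain ⟨V, _, ⟨e⟩⟩ := hJ
  let t' := (dualCofreeIso V).hom ≫ dualMap e.hom ≫ t
  let u : (V →ₗ[k] k) →ₗ[k] (N.A →ₗ[k] k) := t'.f.hom ∘ₗ contraUnit k D (V →ₗ[k] k)
  let s : N.A →ₗ[k] V := (Module.evalEquiv k V).symm.toLinearMap ∘ₗ u.flip
  have hs (ξ : V →ₗ[k] k) (n : N.A) : ξ (s n) = u ξ n := by
    simp [s]
  have ht : t' = (dualCofreeIso V).hom ≫ dualMap (cofreeLift s) := by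
    refine free_hom_ext fun ξ => LinearMap.ext fun n => ?_
    refine (hs ξ n).symm.trans ?_
    refine (congrArg (DFunLike.coe (F := V →ₗ[k] k) ξ)
      (cofreeLift_counit (D := D) s n)).symm.trans ?_
    exact (dualCofreeIso_unit V ξ _).symm
  refine ⟨cofreeLift s ≫ e.inv, ?_⟩
  rw [dualMap_comp, ← (cancel_epi (dualCofreeIso V).hom).1 ht, ← Category.assoc, ← dualMap_comp,
    e.hom_inv_id, dualMap_id, Category.id_comp]

/-- A functional on `N ⊙_D J*` is a contramodule map `J* → N*` by the adjunction between `⊙_D` and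
duality, and such maps are dual to comodule maps. -/
theorem FinCofree.exists_hom_eq_functional {N J : RightComod k D} (hJ : FinCofree J)
    (ψ : contratensorObj N (dualContra J) →ₗ[k] k) :
    ∃ φ : N ⟶ J, ∀ (n : N.A) (p : J.A →ₗ[k] k),
      ψ (ctMk N (dualContra J) n p) = p (φ.f.hom n) := by
  obtain ⟨φ, hφ⟩ := hJ.exists_dualMap_eq (toDual ψ)
  exact ⟨φ, fun n p => (LinearMap.congr_fun (congrArg (fun t => t.f.hom p) hφ :) n).symm⟩

/-- The functional `n ⊗ p ↦ p (φ n)` on `N ⊙_D Hom_k(J, k)` given by a map of comodules. -/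
def evalFunctional {N J : RightComod k D} (φ : N ⟶ J) :
    contratensorObj N (dualContra J) →ₗ[k] k :=
  ctLift (P := dualContra J) (LinearMap.id.flip ∘ₗ φ.f.hom) (by
    intro n (h : D →ₗ[k] J.A →ₗ[k] k)
    refine (congrArg (TensorProduct.lift h.flip) (RightComod.coact_hom φ n)).trans ?_
    generalize N.coact n = z
    induction z with
    | zero => simp
    | add a b ha hb => simp only [map_add, ha, hb]
    | tmul a b => rfl)

end

/-! ### Approximation by duals of finitely cogenerated cofree comodules -/

section

variable {k : Type u} [Field k] {D : Type u} [AddCommGroup D] [Module k D] [Coalgebra k D]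

/-- The map `N ⊙_D g`. -/
def ctRight (N : RightComod k D) {P P' : LeftContra k D} (g : P ⟶ P') :
    contratensorObj N P →ₗ[k] contratensorObj N P' := (contratensorMap (𝟙 N) g).hom

/-- The map `f ⊙_D P`. -/
def ctLeft {N N' : RightComod k D} (f : N ⟶ N') (P : LeftContra k D) :
    contratensorObj N P →ₗ[k] contratensorObj N' P := (contratensorMap f (𝟙 P)).hom

theorem ctRight_comp (N : RightComod k D) {P P' P'' : LeftContra k D} (f : P ⟶ P')
    (g : P' ⟶ P'') (z : contratensorObj N P) :
    ctRight N (f ≫ g) z = ctRight N g (ctRight N f z) :=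
  LinearMap.congr_fun (ct_hom_ext (f := ctRight N (f ≫ g)) (g := ctRight N g ∘ₗ ctRight N f)
    fun _ _ => rfl) z

theorem ctRight_add (N : RightComod k D) {P P' : LeftContra k D} (f g : P ⟶ P')
    (z : contratensorObj N P) : ctRight N (f + g) z = ctRight N f z + ctRight N g z :=
  LinearMap.congr_fun (ct_hom_ext (f := ctRight N (f + g)) (g := ctRight N f + ctRight N g)
    fun n p => (ctMk N P' n).map_add (f.f.hom p) (g.f.hom p)) z

theorem ctRight_zero (N : RightComod k D) {P P' : LeftContra k D}
    (z : contratensorObj N P) : ctRight N (0 : P ⟶ P') z = 0 :=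
  LinearMap.congr_fun (ct_hom_ext (f := ctRight N (0 : P ⟶ P')) (g := 0)
    fun n _ => (ctMk N P' n).map_zero) z

theorem ctLeft_ctRight {N N' : RightComod k D} {P P' : LeftContra k D} (f : N ⟶ N') (g : P ⟶ P')
    (z : contratensorObj N P) : ctLeft f P' (ctRight N g z) = ctRight N' g (ctLeft f P z) :=
  LinearMap.congr_fun (ct_hom_ext (f := ctLeft f P' ∘ₗ ctRight N g)
    (g := ctRight N' g ∘ₗ ctLeft f P) fun _ _ => rfl) z

theorem ct_induction {N : RightComod k D} {P : LeftContra k D} {C : contratensorObj N P → Prop}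
    (zero : C 0) (tmul : ∀ n p, C (ctMk N P n p)) (add : ∀ x y, C x → C y → C (x + y))
    (z : contratensorObj N P) : C z := by
  obtain ⟨t, rfl⟩ := Submodule.mkQ_surjective _ z
  induction t with
  | zero => rw [map_zero]; exact zero
  | tmul n p => exact tmul n p
  | add x y hx hy => rw [map_add]; exact add _ _ hx hy

/-- The map from the dual of a direct sum with given components. -/
def dualDesc {J J' : RightComod k D} {P : LeftContra k D} (l : dualContra J ⟶ P)
    (l' : dualContra J' ⟶ P) : dualContra (J ⊞ J') ⟶ P :=
  dualMap biprod.inl ≫ l + dualMap biprod.inr ≫ l'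

theorem dualMap_fst_dualDesc {J J' : RightComod k D} {P : LeftContra k D} (l : dualContra J ⟶ P)
    (l' : dualContra J' ⟶ P) : dualMap biprod.fst ≫ dualDesc l l' = l := by
  rw [dualDesc, Preadditive.comp_add, ← Category.assoc, ← Category.assoc, ← dualMap_comp,
    ← dualMap_comp, biprod.inl_fst, biprod.inr_fst, dualMap_zero, dualMap_id, zero_comp,
    Category.id_comp, add_zero]

theorem dualMap_snd_dualDesc {J J' : RightComod k D} {P : LeftContra k D} (l : dualContra J ⟶ P)
    (l' : dualContra J' ⟶ P) : dualMap biprod.snd ≫ dualDesc l l' = l' := by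
  rw [dualDesc, Preadditive.comp_add, ← Category.assoc, ← Category.assoc, ← dualMap_comp,
    ← dualMap_comp, biprod.inl_snd, biprod.inr_snd, dualMap_zero, dualMap_id, zero_comp,
    Category.id_comp, zero_add]

/-- An element `p` of `P` is the image of the generator under a map to `P` from the free
contramodule of rank one, which takes care of `n ⊗ p`. Sums are handled by direct sums of the
comodules `J`. -/
theorem exists_ctRight_eq {N : RightComod k D} {P : LeftContra k D} (z : contratensorObj N P) :
    ∃ (J : RightComod k D) (_ : FinCofree J) (l : dualContra J ⟶ P)
      (z' : contratensorObj N (dualContra J)), ctRight N l z' = z := by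
  have hk : FinCofree ((rightComonad k D).cofree.obj (ModuleCat.of k k)) :=
    ⟨_, inferInstanceAs (Module.Finite k k), ⟨Iso.refl _⟩⟩
  induction z using ct_induction with
  | zero => exact ⟨_, hk, 0, 0, map_zero _⟩
  | tmul n p =>
    let u : (k →ₗ[k] k) →ₗ[k] P.A := (LinearMap.applyₗ (1 : k)).smulRight p
    refine ⟨_, hk, (dualCofreeIso _).inv ≫ freeLift (W := ModuleCat.of k (k →ₗ[k] k)) u,
      ctMk N _ n ((dualCofreeIso _).hom.f.hom (contraUnit k D (k →ₗ[k] k) LinearMap.id)), ?_⟩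
    have h := congrArg (fun t : (contraMonad k D).free.obj (ModuleCat.of k (k →ₗ[k] k)) ⟶ P =>
        t.f.hom (contraUnit k D (k →ₗ[k] k) LinearMap.id))
      ((dualCofreeIso (ModuleCat.of k k)).hom_inv_id_assoc (freeLift u))
    refine congrArg (ctMk N P n) (h.trans ((freeLift_unit _ _).trans ?_))
    simp [u]
  | add x y hx hy =>
    obtain ⟨J, hJ, l, z, rfl⟩ := hx
    obtain ⟨J', hJ', l', z', rfl⟩ := hy
    refine ⟨J ⊞ J', hJ.biprod hJ', dualDesc l l',
      ctRight N (dualMap biprod.fst) z + ctRight N (dualMap biprod.snd) z', ?_⟩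
    rw [map_add, ← ctRight_comp, ← ctRight_comp, dualMap_fst_dualDesc, dualMap_snd_dualDesc]

/-! ### Exactness -/

instance : PreservesFiniteLimits (rightComonad k D).forget := by
  have : PreservesFiniteLimits (rightComonad k D).toFunctor := (exact_of_additive _).1
  exact ⟨fun _ _ _ => inferInstance⟩

instance : PreservesFiniteColimits (rightComonad k D).forget := ⟨fun _ _ _ => inferInstance⟩

instance : (rightComonad k D).forget.Additive where

instance : (contraMonad k D).forget.Additive where

instance : PreservesFiniteLimits (contraMonad k D).forget := ⟨fun _ _ _ => inferInstance⟩

instance : PreservesFiniteColimits (contraMonad k D).forget := by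
  have : PreservesFiniteColimits (contraMonad k D).toFunctor := (exact_of_additive _).2
  exact ⟨fun _ _ _ => inferInstance⟩

theorem RightComod.exact_iff (S : ShortComplex (RightComod k D)) :
    S.Exact ↔ Function.Exact S.f.f.hom S.g.f.hom := by
  rw [← ShortComplex.exact_map_iff_of_faithful S (rightComonad k D).forget]
  exact ShortComplex.ShortExact.moduleCat_exact_iff_function_exact _

theorem LeftContra.exact_iff (S : ShortComplex (LeftContra k D)) :
    S.Exact ↔ Function.Exact S.f.f.hom S.g.f.hom := by
  rw [← ShortComplex.exact_map_iff_of_faithful S (contraMonad k D).forget]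
  exact ShortComplex.ShortExact.moduleCat_exact_iff_function_exact _

theorem RightComod.surjective_of_epi {N N' : RightComod k D} (f : N ⟶ N') [Epi f] :
    Function.Surjective f.f.hom :=
  (ModuleCat.epi_iff_surjective _).1 (inferInstanceAs (Epi ((rightComonad k D).forget.map f)))

theorem RightComod.injective_of_mono {N N' : RightComod k D} (f : N ⟶ N') [Mono f] :
    Function.Injective f.f.hom :=
  (ModuleCat.mono_iff_injective _).1 (inferInstanceAs (Mono ((rightComonad k D).forget.map f)))

theorem FinCofree.finCopresented {J : RightComod k D} (hJ : FinCofree J) : J.FinCopresented := by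
  obtain ⟨V, hV, ⟨e⟩⟩ := hJ
  refine ⟨V, V, hV, hV, e.hom, 0, RightComod.injective_of_mono _, fun y => ⟨fun _ => ?_, fun _ => rfl⟩⟩
  exact RightComod.surjective_of_epi e.hom y

/-- Over a right cocoherent coalgebra, any map of finitely cogenerated cofree comodules has a
finitely cogenerated cokernel. -/
theorem IsRightCocoherent.exists_exact (hD : IsRightCocoherent k D) {J₀ J₁ : RightComod k D}
    (h₀ : FinCofree J₀) (h₁ : FinCofree J₁) (g : J₀ ⟶ J₁) :
    ∃ (J₂ : RightComod k D) (_ : FinCofree J₂) (h : J₁ ⟶ J₂),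
      Function.Exact g.f.hom h.f.hom := by
  have hM : (image g).FinCogenerated := by
    obtain ⟨V, hV, ⟨e⟩⟩ := h₁
    exact ⟨V, hV, image.ι g ≫ e.hom, RightComod.injective_of_mono _⟩
  obtain ⟨V, W, hV, hW, i, q, hi, hiq⟩ := hD _ _ (factorThruImage g)
    (RightComod.surjective_of_epi _) h₀.finCopresented hM
  have : Mono i := (rightComonad k D).forget.mono_of_mono_map ((ModuleCat.mono_iff_injective _).2 hi)
  have := h₁.injective
  -- The given copresentation of the image uses its own embedding `i`, unrelated to `J₁`.
  -- Injectivity of both cofree comodules supplies comparison maps `α` and `β` that are compatible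
  -- with the two embeddings.
  let α : J₁ ⟶ (rightComonad k D).cofree.obj V := Injective.factorThru i (image.ι g)
  let β : (rightComonad k D).cofree.obj V ⟶ J₁ := Injective.factorThru (image.ι g) i
  have hα : image.ι g ≫ α = i := Injective.comp_factorThru _ _
  have hβ : i ≫ β = image.ι g := Injective.comp_factorThru _ _
  have hg : factorThruImage g ≫ i ≫ β = g := by rw [hβ, image.fac]
  have hgα : g ≫ α = factorThruImage g ≫ i := by rw [← hα, image.fac_assoc]
  have hiq0 : i ≫ q = 0 := RightComod.hom_ext fun m => (hiq _).2 ⟨m, rfl⟩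
  -- The image of `g` is cut out in `J₁` by the equations `x = β (α x)` and `q (α x) = 0`: the
  -- second puts `α x` in the image of `i`, and then the first puts `x` in the image of `g`.
  refine ⟨J₁ ⊞ (rightComonad k D).cofree.obj W, h₁.biprod ⟨W, hW, ⟨Iso.refl _⟩⟩,
    biprod.lift (𝟙 _ - α ≫ β) (α ≫ q), fun x => ⟨fun hx => ?_, ?_⟩⟩
  · have h1 : x - β.f.hom (α.f.hom x) = 0 := by
      have : (biprod.lift (𝟙 _ - α ≫ β) (α ≫ q) ≫ biprod.fst).f.hom x = 0 :=
        (congrArg (biprod.fst : J₁ ⊞ (rightComonad k D).cofree.obj W ⟶ _).f.hom hx).trans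
          (map_zero _)
      rwa [biprod.lift_fst] at this
    have h2 : q.f.hom (α.f.hom x) = 0 := by
      have : (biprod.lift (𝟙 _ - α ≫ β) (α ≫ q) ≫ biprod.snd).f.hom x = 0 :=
        (congrArg (biprod.snd : J₁ ⊞ (rightComonad k D).cofree.obj W ⟶ _).f.hom hx).trans
          (map_zero _)
      rwa [biprod.lift_snd] at this
    obtain ⟨m, hm⟩ := (hiq _).1 h2
    obtain ⟨y, rfl⟩ := RightComod.surjective_of_epi (factorThruImage g) m
    refine ⟨y, ?_⟩
    rw [sub_eq_zero.1 h1, ← hm]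
    exact (congrArg (fun t => t.f.hom y) hg).symm
  · rintro ⟨y, rfl⟩
    have : g ≫ biprod.lift (𝟙 _ - α ≫ β) (α ≫ q) = 0 := by
      apply biprod.hom_ext
      · simp [reassoc_of% hgα, hg]
      · simp [reassoc_of% hgα, hiq0]
    exact congrArg (fun t => t.f.hom y) this

end

/-! ### Maps of free contramodules and of cofree left comodules -/

section

open Coalgebra

variable {k : Type u} [Field k] {D : Type u} [AddCommGroup D] [Module k D] [Coalgebra k D]

instance : Abelian (LeftComod k D) := abelianCoalgebra _

instance : PreservesFiniteLimits (leftComonad k D).forget := by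
  have : PreservesFiniteLimits (leftComonad k D).toFunctor := (exact_of_additive _).1
  exact ⟨fun _ _ _ => inferInstance⟩

instance : PreservesFiniteColimits (leftComonad k D).forget := ⟨fun _ _ _ => inferInstance⟩

theorem LeftComod.surjective_of_epi {N N' : LeftComod k D} (f : N ⟶ N') [Epi f] :
    Function.Surjective f.f.hom :=
  (ModuleCat.epi_iff_surjective _).1 (inferInstanceAs (Epi ((leftComonad k D).forget.map f)))

theorem LeftComod.injective_of_mono {N N' : LeftComod k D} (f : N ⟶ N') [Mono f] :
    Function.Injective f.f.hom :=
  (ModuleCat.mono_iff_injective _).1 (inferInstanceAs (Mono ((leftComonad k D).forget.map f)))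

instance (V : ModuleCat.{u} k) : Injective ((leftComonad k D).cofree.obj V) := by
  have : Injective V := by
    have := Module.injective_of_isSemisimpleRing k V
    exact Module.injective_object_of_injective_module k V
  exact (leftComonad k D).adj.map_injective _ inferInstance

variable {U V W : ModuleCat.{u} k}

/-- The linear map `W → Hom_k(D, V)` underlying a map of free contramodules. -/
def freeGen (g : (contraMonad k D).free.obj W ⟶ (contraMonad k D).free.obj V) :
    W →ₗ[k] (D →ₗ[k] V) := g.f.hom ∘ₗ contraUnit k D W

theorem free_hom_apply (g : (contraMonad k D).free.obj W ⟶ (contraMonad k D).free.obj V)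
    (f : D →ₗ[k] W) : g.f.hom f = contraMul k D V (freeGen g ∘ₗ f) := by
  have : g = freeLift (P := (contraMonad k D).free.obj V) (freeGen g) :=
    free_hom_ext fun w => (freeLift_unit (P := (contraMonad k D).free.obj V) (freeGen g) w).symm
  exact congrArg (fun t => t.f.hom f) this

/-- The map `D ⊗ W → D ⊗ V` of cofree left comodules corresponding to a map
`Hom_k(D, W) → Hom_k(D, V)` of free left contramodules. -/
def toCofree (g : (contraMonad k D).free.obj W ⟶ (contraMonad k D).free.obj V) :
    (leftComonad k D).cofree.obj W ⟶ (leftComonad k D).cofree.obj V :=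
  (leftComonad k D).cofreeLift (ModuleCat.ofHom (TensorProduct.lift (freeGen g).flip))

/-- The linear map underlying `toCofree g`. -/
def toCofreeLin (g : (contraMonad k D).free.obj W ⟶ (contraMonad k D).free.obj V) :
    D ⊗[k] W →ₗ[k] D ⊗[k] V := (toCofree g).f.hom

theorem toCofree_apply (g : (contraMonad k D).free.obj W ⟶ (contraMonad k D).free.obj V)
    (z : D ⊗[k] W) : toCofreeLin g z =
      (TensorProduct.lift (freeGen g).flip).lTensor D (leftComul k D W z) := rfl

theorem toCofree_tmul (g : (contraMonad k D).free.obj W ⟶ (contraMonad k D).free.obj V)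
    (x : D) (w : W) : toCofreeLin g (x ⊗ₜ w) = (freeGen g w).lTensor D (comul x) := by
  rw [toCofree_apply, leftComul_tmul k D w x _ _ _ (ℛ k x).eq]
  conv_rhs => rw [← (ℛ k x).eq]
  simp

theorem toCofree_counit (g : (contraMonad k D).free.obj W ⟶ (contraMonad k D).free.obj V)
    (z : D ⊗[k] W) : leftCounit k D V ((toCofree g).f.hom z) =
      TensorProduct.lift (freeGen g).flip z :=
  LinearMap.congr_fun (congrArg ModuleCat.Hom.hom
    ((leftComonad k D).cofreeLift_counit (N := (leftComonad k D).cofree.obj W)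
      (ModuleCat.ofHom (TensorProduct.lift (freeGen g).flip)))) z

theorem toCofree_comp (g : (contraMonad k D).free.obj W ⟶ (contraMonad k D).free.obj V)
    (h : (contraMonad k D).free.obj V ⟶ (contraMonad k D).free.obj U) :
    toCofree (g ≫ h) = toCofree g ≫ toCofree h := by
  apply (leftComonad k D).cofree_hom_ext
  ext : 1
  refine TensorProduct.ext' (R := k) (M := D) (N := W) fun x w => ?_
  refine (toCofree_counit (g ≫ h) (x ⊗ₜ w)).trans
    (Eq.trans ?_ (toCofree_counit h ((toCofree g).f.hom (x ⊗ₜ w))).symm)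
  change _ = TensorProduct.lift (freeGen h).flip (toCofreeLin g (x ⊗ₜ w))
  rw [toCofree_tmul]
  have h1 : freeGen (g ≫ h) w = contraMul k D U (freeGen h ∘ₗ freeGen g w) :=
    free_hom_apply h (freeGen g w)
  rw [TensorProduct.lift.tmul, LinearMap.flip_apply, h1, contraMul_apply k D _ x _ _ _ (ℛ k x).eq]
  conv_rhs => rw [← (ℛ k x).eq]
  simp

theorem toCofree_injective {g h : (contraMonad k D).free.obj W ⟶ (contraMonad k D).free.obj V}
    (hgh : toCofree g = toCofree h) : g = h := by
  refine free_hom_ext fun w => LinearMap.ext fun x => ?_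
  have := congrArg (fun t => leftCounit k D V (t.f.hom (x ⊗ₜ w))) hgh
  simp only [toCofree_counit] at this
  exact this

/-- Both kinds of maps are linear maps `D ⊗ W → V`: by currying for free contramodules, by composing
with the counit for cofree comodules. This holds without any finiteness of `V` or `W`, and lets a
condition on left comodules be used for contramodules. -/
theorem toCofree_surjective
    (t : (leftComonad k D).cofree.obj W ⟶ (leftComonad k D).cofree.obj V) :
    ∃ g : (contraMonad k D).free.obj W ⟶ (contraMonad k D).free.obj V, toCofree g = t := by
  let s : D ⊗[k] W →ₗ[k] V := leftCounit k D V ∘ₗ t.f.hom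
  refine ⟨freeLift (P := (contraMonad k D).free.obj V) (TensorProduct.curry s).flip, ?_⟩
  apply (leftComonad k D).cofree_hom_ext
  ext : 1
  refine TensorProduct.ext' (R := k) (M := D) (N := W) fun x w => ?_
  refine (toCofree_counit _ (x ⊗ₜ w)).trans ?_
  rw [TensorProduct.lift.tmul, LinearMap.flip_apply]
  exact LinearMap.congr_fun (freeLift_unit (P := (contraMonad k D).free.obj V) _ w) x

theorem toCofree_zero :
    toCofree (0 : (contraMonad k D).free.obj W ⟶ (contraMonad k D).free.obj V) = 0 := by
  apply (leftComonad k D).cofree_hom_ext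
  ext : 1
  refine TensorProduct.ext' (R := k) (M := D) (N := W) fun x w => ?_
  refine (toCofree_counit _ (x ⊗ₜ w)).trans ?_
  exact (map_zero (leftCounit k D V)).symm

/-! ### The contratensor product with a free contramodule -/

variable (N : RightComod k D)

/-- The surjection `N ⊗ W → N ⊙_D Hom_k(D, W)`. -/
def ofTensor (W : ModuleCat.{u} k) :
    N.A ⊗[k] W →ₗ[k] contratensorObj N ((contraMonad k D).free.obj W) :=
  TensorProduct.lift ((ctMk N ((contraMonad k D).free.obj W)).compl₂ (contraUnit k D W))

/-- Any `f` is the contraaction of the family of generators `x ↦ η (f x)`, where `η` is the unit, so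
the balancing relation moves all of `f` across the tensor sign. -/
theorem ofTensor_coact (n : N.A) (f : D →ₗ[k] W) :
    ofTensor N W (f.lTensor N.A (N.coact n)) = ctMk N ((contraMonad k D).free.obj W) n f := by
  refine Eq.trans ?_ ((ctMk_contraact (P := (contraMonad k D).free.obj W) n
    (contraUnit k D W ∘ₗ f)).symm.trans
      (congrArg (ctMk N ((contraMonad k D).free.obj W) n) (contraMul_map_unit k D f)))
  generalize N.coact n = z
  induction z with
  | zero => simp
  | add a b ha hb => simp only [map_add, ha, hb]
  | tmul a b => rfl

theorem ofTensor_surjective (W : ModuleCat.{u} k) : Function.Surjective (ofTensor N W) := by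
  intro z
  induction z using ct_induction with
  | zero => exact ⟨0, map_zero _⟩
  | tmul n f => exact ⟨_, ofTensor_coact N n f⟩
  | add x y hx hy =>
    obtain ⟨a, rfl⟩ := hx
    obtain ⟨b, rfl⟩ := hy
    exact ⟨a + b, map_add _ _ _⟩

/-- The inverse `n ⊗ f ↦ n₍₀₎ ⊗ f n₍₁₎` of `ofTensor`. -/
def toTensor (W : ModuleCat.{u} k) :
    contratensorObj N ((contraMonad k D).free.obj W) →ₗ[k] N.A ⊗[k] W :=
  ctLift (P := (contraMonad k D).free.obj W)
    ((LinearMap.lflip (R₀ := k) (LinearMap.lTensorHom (R := k) (N := D) (P := W) N.A)) ∘ₗ N.coact) (by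
    intro n (h : D →ₗ[k] (D →ₗ[k] W))
    change (contraMul k D W h).lTensor N.A (N.coact n) = _
    -- Balancedness is `Ψ` applied to the coassociativity of `N`.
    let Ψ : (N.A ⊗[k] D) ⊗[k] D →ₗ[k] N.A ⊗[k] W :=
      TensorProduct.lift ((LinearMap.lTensorHom N.A ∘ₗ h).flip)
    have h1 : (contraMul k D W h).lTensor N.A = Ψ ∘ₗ rightComul k D N.A := by
      refine TensorProduct.ext' fun n x => ?_
      rw [LinearMap.comp_apply, rightComul_tmul k D n x _ _ _ (ℛ k x).eq, LinearMap.lTensor_tmul,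
        contraMul_apply k D h x _ _ _ (ℛ k x).eq]
      simp [Ψ, TensorProduct.tmul_sum]
    rw [h1, LinearMap.comp_apply, N.coassoc_coact]
    generalize N.coact n = z
    induction z with
    | zero => simp
    | add a b ha hb => simp only [map_add, ha, hb]
    | tmul a b => rfl)

/-- The map `N ⊗ W → N ⊗ V`, `n ⊗ w ↦ n₍₀₎ ⊗ u w n₍₁₎`. -/
def tensorAct (u : W →ₗ[k] (D →ₗ[k] V)) : N.A ⊗[k] W →ₗ[k] N.A ⊗[k] V :=
  TensorProduct.lift ((LinearMap.lTensorHom (R := k) (N := D) (P := V) N.A ∘ₗ u).flip ∘ₗ N.coact)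

theorem tensorAct_tmul (u : W →ₗ[k] (D →ₗ[k] V)) (n : N.A) (w : W) :
    tensorAct N u (n ⊗ₜ w) = (u w).lTensor N.A (N.coact n) := rfl

theorem ctRight_ofTensor (g : (contraMonad k D).free.obj W ⟶ (contraMonad k D).free.obj V)
    (z : N.A ⊗[k] W) :
    ctRight N g (ofTensor N W z) = ofTensor N V (tensorAct N (freeGen g) z) := by
  refine LinearMap.congr_fun (f := ctRight N g ∘ₗ ofTensor N W)
    (g := ofTensor N V ∘ₗ tensorAct N (freeGen g)) (TensorProduct.ext' fun n w => ?_) z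
  exact (ofTensor_coact N n (freeGen g w)).symm

theorem toTensor_ofTensor (z : N.A ⊗[k] W) : toTensor N W (ofTensor N W z) = z := by
  refine LinearMap.congr_fun (f := toTensor N W ∘ₗ ofTensor N W)
    (g := LinearMap.id) (TensorProduct.ext' fun n w => ?_) z
  change (contraUnit k D W w).lTensor N.A (N.coact n) = n ⊗ₜ w
  conv_rhs => rw [← N.counit_coact n]
  generalize N.coact n = z
  induction z with
  | zero => simp
  | add a b ha hb => simp only [map_add, ha, hb, TensorProduct.add_tmul]
  | tmul a b => simp [contraUnit, rightCounit, TensorProduct.smul_tmul]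

/-- The injection `N ⊗ W → N ⊗ (D ⊗ W)`. -/
def tensorCoact (W : ModuleCat.{u} k) : N.A ⊗[k] W →ₗ[k] N.A ⊗[k] (D ⊗[k] W) :=
  (TensorProduct.assoc k N.A D W).toLinearMap ∘ₗ N.coact.rTensor W

/-- The counit of `D` gives a left inverse. -/
theorem tensorCoact_injective (W : ModuleCat.{u} k) : Function.Injective (tensorCoact N W) := by
  refine Function.LeftInverse.injective (g := (leftCounit k D W).lTensor N.A) fun z => ?_
  refine LinearMap.congr_fun (f := (leftCounit k D W).lTensor N.A ∘ₗ tensorCoact N W)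
    (g := LinearMap.id) (TensorProduct.ext' fun n w => ?_) z
  conv_rhs => rw [← N.counit_coact n]
  simp only [tensorCoact, LinearMap.comp_apply, LinearMap.rTensor_tmul]
  generalize N.coact n = z
  induction z with
  | zero => simp
  | add a b ha hb => simp only [map_add, ha, hb, TensorProduct.add_tmul]
  | tmul a b => simp [leftCounit, rightCounit, TensorProduct.smul_tmul]

/-- Under the identification of `N ⊙_D Hom(D, W)` with `N ⊗ W` and the embedding of the latter into
`N ⊗ (D ⊗ W)`, the map `N ⊙_D g` becomes the restriction of `N ⊗ toCofree g`. Hence its kernel is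
controlled by exactness of tensor products over `k`. The identity is coassociativity of `N`. -/
theorem tensorCoact_tensorAct
    (g : (contraMonad k D).free.obj W ⟶ (contraMonad k D).free.obj V) (z : N.A ⊗[k] W) :
    tensorCoact N V (tensorAct N (freeGen g) z) =
      (toCofreeLin g).lTensor N.A (tensorCoact N W z) := by
  refine LinearMap.congr_fun (f := tensorCoact N V ∘ₗ tensorAct N (freeGen g))
    (g := (toCofreeLin g).lTensor N.A ∘ₗ tensorCoact N W)
    (TensorProduct.ext' fun n w => ?_) z
  let Ψ : (N.A ⊗[k] D) ⊗[k] D →ₗ[k] N.A ⊗[k] (D ⊗[k] V) :=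
    (TensorProduct.assoc k N.A D V).toLinearMap ∘ₗ (freeGen g w).lTensor (N.A ⊗[k] D)
  have h1 : Ψ (N.coact.rTensor D (N.coact n)) =
      tensorCoact N V (tensorAct N (freeGen g) (n ⊗ₜ w)) := by
    rw [tensorAct_tmul]
    generalize N.coact n = z
    induction z with
    | zero => simp
    | add a b ha hb => simp only [map_add, ha, hb]
    | tmul a b => rfl
  have h2 : Ψ (rightComul k D N.A (N.coact n)) =
      (toCofreeLin g).lTensor N.A (tensorCoact N W (n ⊗ₜ w)) := by
    simp only [tensorCoact, LinearMap.comp_apply, LinearMap.rTensor_tmul]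
    generalize N.coact n = z
    induction z with
    | zero => simp
    | add a b ha hb => simp only [map_add, ha, hb, TensorProduct.add_tmul]
    | tmul a x =>
      refine Eq.trans ?_ (congrArg (fun t => a ⊗ₜ[k] t) (toCofree_tmul g x w)).symm
      rw [rightComul_tmul k D a x _ _ _ (ℛ k x).eq]
      conv_rhs => rw [← (ℛ k x).eq]
      simp [Ψ, TensorProduct.tmul_sum]
  exact h1.symm.trans ((congrArg Ψ (N.coassoc_coact n)).symm.trans h2)

variable {N}

/-- Over a left co-Noetherian coalgebra, any map from a finitely generated free contramodule to a
free contramodule factors through a finitely generated free contramodule in such a way that no new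
relations are imposed. -/
theorem IsLeftCoNoetherian.exists_factor_free (hD : IsLeftCoNoetherian k D) [Module.Finite k W]
    (g : (contraMonad k D).free.obj W ⟶ (contraMonad k D).free.obj V) :
    ∃ (U : ModuleCat.{u} k) (_ : Module.Finite k U)
      (h : (contraMonad k D).free.obj W ⟶ (contraMonad k D).free.obj U)
      (y : (contraMonad k D).free.obj U ⟶ (contraMonad k D).free.obj V),
      h ≫ y = g ∧
      (∀ (T : ModuleCat.{u} k) (t : (contraMonad k D).free.obj T ⟶ (contraMonad k D).free.obj W),
        t ≫ g = 0 → t ≫ h = 0) ∧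
      ∀ (N : RightComod k D) (z : contratensorObj N ((contraMonad k D).free.obj W)),
        ctRight N g z = 0 → ctRight N h z = 0 := by
  let p := factorThruImage (toCofree g)
  let j := image.ι (toCofree g)
  have hpj : p ≫ j = toCofree g := image.fac _
  -- The image of `toCofree g` is a quotient of `D ⊗ W`, so it embeds into some `D ⊗ U` with `U`
  -- finite-dimensional. The factor `h` corresponds to `D ⊗ W → image → D ⊗ U`.
  obtain ⟨U, hU, i, hi⟩ := hD _ _ p (LeftComod.surjective_of_epi p)
    ⟨W, inferInstance, 𝟙 _, fun _ _ h => h⟩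
  have : Mono i := (leftComonad k D).forget.mono_of_mono_map ((ModuleCat.mono_iff_injective _).2 hi)
  obtain ⟨h, hh⟩ := toCofree_surjective (p ≫ i)
  -- Injectivity of `D ⊗ V` extends the inclusion of the image to `D ⊗ U`. As `toCofree h` and
  -- `toCofree g` have the same kernel, no relation is added.
  obtain ⟨y, hy⟩ := toCofree_surjective (Injective.factorThru j i)
  refine ⟨U, hU, h, y, toCofree_injective ?_, fun T t ht => toCofree_injective ?_, fun N z hz => ?_⟩
  · rw [toCofree_comp, hh, hy, Category.assoc, Injective.comp_factorThru, hpj]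
  · have h1 : (toCofree t ≫ p) ≫ j = 0 ≫ j := by
      rw [Category.assoc, hpj, ← toCofree_comp, ht, toCofree_zero, zero_comp]
    rw [toCofree_comp, hh, ← Category.assoc, (cancel_mono j).1 h1, zero_comp, toCofree_zero]
  · obtain ⟨z, rfl⟩ := ofTensor_surjective N W z
    rw [ctRight_ofTensor] at hz ⊢
    have h1 : tensorAct N (freeGen g) z = 0 := by
      rw [← toTensor_ofTensor N (tensorAct N (freeGen g) z), hz, map_zero]
    have h2 := tensorCoact_tensorAct N g z
    rw [h1, map_zero] at h2
    -- Flatness over the field cancels the inclusion of the image after tensoring with `N`.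
    have hinj : Function.Injective (LinearMap.lTensor N.A j.f.hom) :=
      Module.Flat.lTensor_preserves_injective_linearMap j.f.hom (LeftComod.injective_of_mono j)
    have h3 : LinearMap.lTensor N.A p.f.hom (tensorCoact N W z) = 0 := by
      refine hinj (Eq.trans ?_ (map_zero _).symm)
      refine (LinearMap.lTensor_comp_apply N.A j.f.hom p.f.hom _).symm.trans ?_
      have hg : toCofreeLin g = j.f.hom ∘ₗ p.f.hom := congrArg (fun t => t.f.hom) hpj.symm
      exact (congrArg (fun t => LinearMap.lTensor N.A t (tensorCoact N W z)) hg).symm.trans h2.symm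
    have h4 : tensorAct N (freeGen h) z = 0 := by
      apply tensorCoact_injective N U
      rw [map_zero, tensorCoact_tensorAct]
      have hh' : toCofreeLin h = i.f.hom ∘ₗ p.f.hom := congrArg (fun t => t.f.hom) hh
      refine (congrArg (fun t => LinearMap.lTensor N.A t (tensorCoact N W z)) hh').trans ?_
      refine (LinearMap.lTensor_comp_apply N.A i.f.hom p.f.hom _).trans ?_
      exact (congrArg _ h3).trans (map_zero _)
    rw [h4, map_zero]

end

/-! ### Approximation of complexes of projective contramodules -/

section

variable {k : Type u} [Field k] {D : Type u} [AddCommGroup D] [Module k D] [Coalgebra k D]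

/-- Dual comodules of isomorphic comodules are isomorphic. -/
def dualIso {J J' : RightComod k D} (e : J ≅ J') : dualContra J' ≅ dualContra J where
  hom := dualMap e.hom
  inv := dualMap e.inv
  hom_inv_id := by rw [← dualMap_comp, e.inv_hom_id, dualMap_id]
  inv_hom_id := by rw [← dualMap_comp, e.hom_inv_id, dualMap_id]

theorem FinCofree.exists_iso_free {J : RightComod k D} (hJ : FinCofree J) :
    ∃ (W : ModuleCat.{u} k) (_ : Module.Finite k W),
      Nonempty (dualContra J ≅ (contraMonad k D).free.obj W) := by
  obtain ⟨V, _, ⟨e⟩⟩ := hJ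
  exact ⟨ModuleCat.of k (V →ₗ[k] k), inferInstanceAs (Module.Finite k (V →ₗ[k] k)),
    ⟨(dualIso e).symm ≪≫ (dualCofreeIso V).symm⟩⟩

/-- Since `W = W**`, the free contramodule on `W` is dual to `W* ⊗ D`. -/
theorem exists_iso_dualContra (W : ModuleCat.{u} k) [Module.Finite k W] :
    ∃ (J : RightComod k D) (_ : FinCofree J),
      Nonempty (dualContra J ≅ (contraMonad k D).free.obj W) :=
  ⟨(rightComonad k D).cofree.obj (ModuleCat.of k (W →ₗ[k] k)),
    ⟨_, inferInstanceAs (Module.Finite k (W →ₗ[k] k)), ⟨Iso.refl _⟩⟩,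
    ⟨(dualCofreeIso _).symm ≪≫ (contraMonad k D).free.mapIso
      (Module.evalEquiv k W).toModuleIso.symm⟩⟩

/-- Over a left co-Noetherian coalgebra, any map from the dual of a finitely cogenerated cofree
comodule to a projective contramodule factors through another such dual in such a way that no new
relations are imposed. -/
theorem IsLeftCoNoetherian.exists_factor (hD : IsLeftCoNoetherian k D) {J : RightComod k D}
    (hJ : FinCofree J) {F : LeftContra k D} [Projective F] (g : dualContra J ⟶ F) :
    ∃ (J' : RightComod k D) (_ : FinCofree J') (c : J' ⟶ J) (y : dualContra J' ⟶ F),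
      dualMap c ≫ y = g ∧
      (∀ (T : RightComod k D) (_ : FinCofree T) (t : dualContra T ⟶ dualContra J),
        t ≫ g = 0 → t ≫ dualMap c = 0) ∧
      ∀ (N : RightComod k D) (z : contratensorObj N (dualContra J)),
        ctRight N g z = 0 → ctRight N (dualMap c) z = 0 := by
  obtain ⟨W, _, ⟨a⟩⟩ := hJ.exists_iso_free
  let ε : (contraMonad k D).free.obj F.A ⟶ F := freeLift LinearMap.id
  have : Epi ε := (contraMonad k D).forget.epi_of_epi_map
    ((ModuleCat.epi_iff_surjective _).2 fun p => ⟨_, freeLift_unit LinearMap.id p⟩)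
  -- A projective `F` is a retract of a free contramodule; composing with the split mono `σ` changes
  -- no relations.
  let σ : F ⟶ (contraMonad k D).free.obj F.A := Projective.factorThru (𝟙 F) ε
  have hσ : σ ≫ ε = 𝟙 F := Projective.factorThru_comp _ _
  obtain ⟨U, _, h, y, hy, h1, h2⟩ := hD.exists_factor_free (a.inv ≫ g ≫ σ)
  obtain ⟨J', hJ', ⟨b⟩⟩ := exists_iso_dualContra (D := D) U
  obtain ⟨c, hc⟩ := hJ.exists_dualMap_eq (a.hom ≫ h ≫ b.inv)
  refine ⟨J', hJ', c, b.hom ≫ y ≫ ε, ?_, fun T hT t ht => ?_, fun N z hz => ?_⟩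
  · rw [hc]
    simp [reassoc_of% hy, hσ]
  · obtain ⟨W', _, ⟨a'⟩⟩ := hT.exists_iso_free
    have := h1 W' (a'.inv ≫ t ≫ a.hom) (by simp [reassoc_of% ht])
    rw [Category.assoc, Category.assoc, ← cancel_epi a'.hom, Iso.hom_inv_id_assoc, comp_zero] at this
    rw [hc, ← Category.assoc a.hom, ← Category.assoc t, this, zero_comp]
  · have := h2 N (ctRight N a.hom z) (by
      rw [← ctRight_comp, Iso.hom_inv_id_assoc, ctRight_comp, hz, map_zero])
    rw [hc, ctRight_comp, ctRight_comp, this, map_zero]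

theorem exists_finCofree : ∃ J : RightComod k D, FinCofree J :=
  ⟨_, ModuleCat.of k k, inferInstanceAs (Module.Finite k k), ⟨Iso.refl _⟩⟩

/-- Over a left co-Noetherian coalgebra, a cycle in the contratensor product with a complex of
projective contramodules comes from a complex of finitely generated free contramodules. -/
theorem IsLeftCoNoetherian.exists_lift_cycle (hD : IsLeftCoNoetherian k D) (m : ℕ)
    (F : ℕ → LeftContra k D) (hF : ∀ i, Projective (F i)) (d : ∀ i, F (i + 1) ⟶ F i)
    (hd : ∀ i, d (i + 1) ≫ d i = 0) (N : ℕ → RightComod k D) (δ : ∀ i, N i ⟶ N (i + 1))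
    (z : ∀ i, contratensorObj (N i) (F i)) (hz0 : ∀ i, m ≤ i → z i = 0)
    (hz : ∀ i, ctLeft (δ i) (F i) (z i) + ctRight (N (i + 1)) (d i) (z (i + 1)) = 0) :
    ∃ (J : ℕ → RightComod k D) (_ : ∀ i, FinCofree (J i)) (e : ∀ i, J i ⟶ J (i + 1))
      (f : ∀ i, dualContra (J i) ⟶ F i) (w : ∀ i, contratensorObj (N i) (dualContra (J i))),
      (∀ i, e i ≫ e (i + 1) = 0) ∧ (∀ i, dualMap (e i) ≫ f i = f (i + 1) ≫ d i) ∧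
      (∀ i, ctRight (N i) (f i) (w i) = z i) ∧
      (∀ i, ctLeft (δ i) _ (w i) + ctRight (N (i + 1)) (dualMap (e i)) (w (i + 1)) = 0) ∧
      ∀ i, m ≤ i → w i = 0 := by
  induction m generalizing F N with
  | zero =>
    obtain ⟨J, hJ⟩ := exists_finCofree (k := k) (D := D)
    exact ⟨fun _ => J, fun _ => hJ, fun _ => 0, fun _ => 0, fun _ => 0, fun _ => zero_comp,
      fun _ => by simp, fun i => by rw [map_zero, hz0 i (Nat.zero_le i)],
      fun _ => by rw [map_zero, map_zero, add_zero], fun _ _ => rfl⟩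
  -- Induction on the number of components: the lift in indices `≥ 1` is given by the hypothesis for
  -- the shifted data, and only index `0` has to be built.
  | succ m ih =>
    obtain ⟨J, hJ, e, f, w, hee, hef, hfw, hw, hw0⟩ := ih (fun i => F (i + 1)) (fun i => hF _)
      (fun i => d (i + 1)) (fun i => hd _) (fun i => N (i + 1)) (fun i => δ (i + 1))
      (fun i => z (i + 1)) (fun i hi => hz0 _ (by lia)) (fun i => hz _)
    obtain ⟨K, hK, l, z', hz'⟩ := exists_ctRight_eq (z 0)
    have := hF 0
    -- The new dual must receive both the differential from the previous one and a lift of `z 0`, so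
    -- the map to `F 0` from the dual of the sum is factored. The identity `e ∘ e = 0` and the cycle
    -- equation hold after mapping to `F 0`, and by `h1` and `h2` already hold in the dual of `J'`.
    obtain ⟨J', hJ', c, y, hy, h1, h2⟩ :=
      hD.exists_factor ((hJ 0).biprod hK) (dualDesc (f 0 ≫ d 0) l)
    refine ⟨fun | 0 => J' | i + 1 => J i, fun | 0 => hJ' | i + 1 => hJ i,
      fun | 0 => c ≫ biprod.fst | i + 1 => e i, fun | 0 => y | i + 1 => f i,
      fun | 0 => ctRight (N 0) (dualMap (c ≫ biprod.snd)) z' | i + 1 => w i, ?_, ?_, ?_, ?_, ?_⟩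
    · rintro (_ | i)
      · apply dualMap_injective
        rw [dualMap_zero]
        refine h1 _ (hJ 1) (dualMap (e 0) ≫ dualMap biprod.fst) ?_
        rw [Category.assoc, dualMap_fst_dualDesc, ← Category.assoc, hef 0, Category.assoc, hd 0,
          comp_zero]
      · exact hee i
    · rintro (_ | i)
      · change dualMap (c ≫ biprod.fst) ≫ y = f 0 ≫ d 0
        rw [dualMap_comp, Category.assoc, hy, dualMap_fst_dualDesc]
      · exact hef i
    · rintro (_ | i)
      · change ctRight (N 0) y (ctRight (N 0) (dualMap (c ≫ biprod.snd)) z') = z 0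
        rw [← ctRight_comp, dualMap_comp, Category.assoc, hy, dualMap_snd_dualDesc, hz']
      · exact hfw i
    · rintro (_ | i)
      · change ctLeft (δ 0) _ (ctRight (N 0) (dualMap (c ≫ biprod.snd)) z') +
          ctRight (N 1) (dualMap (c ≫ biprod.fst)) (w 0) = 0
        rw [ctLeft_ctRight, dualMap_comp, dualMap_comp, ctRight_comp, ctRight_comp, ← map_add]
        apply h2
        rw [map_add, ← ctRight_comp, ← ctRight_comp, dualMap_fst_dualDesc, dualMap_snd_dualDesc,
          ← ctLeft_ctRight, hz', ctRight_comp, hfw 0]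
        exact hz 0
      · exact hw i
    · rintro (_ | i) hi
      · lia
      · exact hw0 i (by lia)

/-! ### Replacing the approximating complex by an exact one -/

variable {F : ℕ → LeftContra k D} {d : ∀ i, F (i + 1) ⟶ F i} {J : ℕ → RightComod k D}
  {e : ∀ i, J i ⟶ J (i + 1)} {f : ∀ i, dualContra (J i) ⟶ F i}

variable (d e f) in
/-- Two consecutive terms of a complex of finitely cogenerated cofree comodules whose dual
factorizes `f`. -/
structure FactorStage (i : ℕ) where
  /-- The first comodule. -/
  A : RightComod k D
  /-- The second comodule. -/
  B : RightComod k D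
  hA : FinCofree A
  hB : FinCofree B
  /-- The differential. -/
  diff : A ⟶ B
  /-- The comparison map on the first comodule. -/
  κA : A ⟶ J i
  /-- The comparison map on the second comodule. -/
  κB : B ⟶ J (i + 1)
  /-- The map from the dual of the first comodule. -/
  fA : dualContra A ⟶ F i
  /-- The map from the dual of the second comodule. -/
  fB : dualContra B ⟶ F (i + 1)
  comm_κ : κA ≫ e i = diff ≫ κB
  comm_f : dualMap diff ≫ fA = fB ≫ d i
  facA : dualMap κA ≫ fA = f i
  facB : dualMap κB ≫ fB = f (i + 1)

/-- Cocoherence continues `A → B` exactly by some `B → C`. The map from the dual of `C` to `F (i +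
1)` lands in cycles, so it lifts to `F (i + 2)` by projectivity. The summand `J (i + 2)` is added to
keep a comparison map; it does not enlarge the image of `A` or shrink the kernel, because `e ∘ e =
0`. -/
theorem FactorStage.exists_next (hD : IsRightCocoherent k D)
    (hd : ∀ i, Function.Exact (d (i + 1)).f.hom (d i).f.hom) (hJ : ∀ i, FinCofree (J i))
    (hee : ∀ i, e i ≫ e (i + 1) = 0) (hef : ∀ i, dualMap (e i) ≫ f i = f (i + 1) ≫ d i)
    {i : ℕ} (s : FactorStage d e f i) :
    ∃ (C : RightComod k D) (_ : FinCofree C) (h : s.B ⟶ C) (κ : C ⟶ J (i + 2))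
      (g : dualContra C ⟶ F (i + 2)), s.κB ≫ e (i + 1) = h ≫ κ ∧
      dualMap h ≫ s.fB = g ≫ d (i + 1) ∧ dualMap κ ≫ g = f (i + 2) ∧
      Function.Exact s.diff.f.hom h.f.hom := by
  obtain ⟨C, hC, h, hex⟩ := hD.exists_exact s.hA s.hB s.diff
  have h0 : s.diff ≫ h = 0 := RightComod.hom_ext fun x => (hex _).2 ⟨x, rfl⟩
  have hd0 : d (i + 1) ≫ d i = 0 := LeftContra.hom_ext fun x => (hd i _).2 ⟨x, rfl⟩
  have := hC.projective_dual
  have hS : (ShortComplex.mk _ _ hd0).Exact := (LeftContra.exact_iff _).2 (hd i)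
  have hl : (dualMap h ≫ s.fB) ≫ d i = 0 := by
    rw [Category.assoc, ← s.comm_f, ← Category.assoc, ← dualMap_comp, h0, dualMap_zero, zero_comp]
  let l : dualContra C ⟶ F (i + 2) := hS.liftFromProjective (dualMap h ≫ s.fB) hl
  have hl' : l ≫ d (i + 1) = dualMap h ≫ s.fB := hS.liftFromProjective_comp _ _
  refine ⟨J (i + 2) ⊞ C, (hJ _).biprod hC, biprod.lift (s.κB ≫ e (i + 1)) h, biprod.fst,
    dualDesc (f (i + 2)) l, (biprod.lift_fst _ _).symm, ?_, dualMap_fst_dualDesc _ _, ?_⟩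
  · rw [biprod.lift_eq, dualMap_add, Preadditive.add_comp, dualDesc, Preadditive.add_comp,
      Category.assoc (dualMap biprod.inr), hl', Category.assoc (dualMap biprod.inl), ← hef,
      ← s.facB]
    rfl
  · refine fun x => ⟨fun hx => (hex x).1 ?_, ?_⟩
    · have : (biprod.lift (s.κB ≫ e (i + 1)) h ≫ biprod.snd).f.hom x = 0 :=
        (congrArg (biprod.snd : J (i + 2) ⊞ C ⟶ _).f.hom hx).trans (map_zero _)
      rwa [biprod.lift_snd] at this
    · rintro ⟨y, rfl⟩
      have : s.diff ≫ biprod.lift (s.κB ≫ e (i + 1)) h = 0 := by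
        apply biprod.hom_ext
        · simp [← reassoc_of% s.comm_κ, hee]
        · simp [h0]
      exact congrArg (fun t => t.f.hom y) this

/-- Over a right cocoherent coalgebra, a map from the dual of a complex of finitely cogenerated
cofree comodules to an acyclic complex factors through the dual of an acyclic complex of the same
kind. -/
theorem IsRightCocoherent.exists_factor_exact (hD : IsRightCocoherent k D)
    (hd : ∀ i, Function.Exact (d (i + 1)).f.hom (d i).f.hom) (hJ : ∀ i, FinCofree (J i))
    (hee : ∀ i, e i ≫ e (i + 1) = 0) (hef : ∀ i, dualMap (e i) ≫ f i = f (i + 1) ≫ d i) :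
    ∃ (J' : ℕ → RightComod k D) (_ : ∀ i, FinCofree (J' i)) (e' : ∀ i, J' i ⟶ J' (i + 1))
      (κ : ∀ i, J' i ⟶ J i) (f' : ∀ i, dualContra (J' i) ⟶ F i),
      (∀ i, κ i ≫ e i = e' i ≫ κ (i + 1)) ∧ (∀ i, dualMap (e' i) ≫ f' i = f' (i + 1) ≫ d i) ∧
      (∀ i, dualMap (κ i) ≫ f' i = f i) ∧
      ∀ i, Function.Exact (e' i).f.hom (e' (i + 1)).f.hom := by
  have hnext : ∀ (i : ℕ) (s : FactorStage d e f i), ∃ (C : RightComod k D) (hC : FinCofree C)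
      (h : s.B ⟶ C) (κ : C ⟶ J (i + 2)) (g : dualContra C ⟶ F (i + 2)),
      s.κB ≫ e (i + 1) = h ≫ κ ∧ dualMap h ≫ s.fB = g ≫ d (i + 1) ∧
      dualMap κ ≫ g = f (i + 2) ∧ Function.Exact s.diff.f.hom h.f.hom :=
    fun i s => s.exists_next hD hd hJ hee hef
  choose C hC h κ g hκ hg hκg hex using hnext
  -- The recursion starts from `J 0 → J 1` unchanged; exactness is only required from the second
  -- term on.
  let s : ∀ i, FactorStage d e f i := fun i => Nat.rec
    { A := J 0, B := J 1, hA := hJ 0, hB := hJ 1, diff := e 0, κA := 𝟙 _, κB := 𝟙 _, fA := f 0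
      fB := f 1, comm_κ := by simp, comm_f := hef 0, facA := Category.id_comp _
      facB := Category.id_comp _ }
    (fun i s => { A := s.B, B := C i s, hA := s.hB, hB := hC i s, diff := h i s, κA := s.κB
                  κB := κ i s, fA := s.fB, fB := g i s, comm_κ := hκ i s, comm_f := hg i s
                  facA := s.facB, facB := hκg i s }) i
  exact ⟨fun i => (s i).A, fun i => (s i).hA, fun i => (s i).diff, fun i => (s i).κA,
    fun i => (s i).fA, fun i => (s i).comm_κ, fun i => (s i).comm_f, fun i => (s i).facA,
    fun i => hex i (s i)⟩

end

/-! ### Injective resolutions from exact sequences -/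

section

variable {C : Type*} [Category* C] [Abelian C] (J : ℕ → C) (e : ∀ i, J i ⟶ J (i + 1))

/-- An exact sequence of injective objects `J₀ → J₁ → ⋯` is an injective resolution of the kernel
of its first map. -/
def resolutionOfExact (hJ : ∀ i, Injective (J i)) (hee : ∀ i, e i ≫ e (i + 1) = 0)
    (hex : ∀ i, (ShortComplex.mk _ _ (hee i)).Exact) : InjectiveResolution (kernel (e 0)) where
  cocomplex := CochainComplex.of J e hee
  injective := hJ
  ι := (CochainComplex.fromSingle₀Equiv _ _).symm ⟨kernel.ι (e 0), by
    exact (congrArg (kernel.ι (e 0) ≫ ·) (CochainComplex.of_d J e 0)).trans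
      (kernel.condition _)⟩
  quasiIso := ⟨fun i => by
    cases i with
    | zero =>
      -- In degree `0` the claim is that the augmentation is the kernel of `e 0`.
      rw [CochainComplex.quasiIsoAt₀_iff, ShortComplex.quasiIso_iff_of_zeros]
      · refine (ShortComplex.exact_and_mono_f_iff_of_iso ?_).2
          ⟨ShortComplex.exact_of_f_is_kernel (ShortComplex.mk _ _ (kernel.condition (e 0)))
            (kernelIsKernel _), by dsimp; infer_instance⟩
        refine ShortComplex.isoMk (Iso.refl _) (Iso.refl _) (Iso.refl _) ?_ ?_
        · refine (Category.id_comp _).trans (Eq.trans ?_ (Category.comp_id _).symm)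
          exact (CochainComplex.fromSingle₀Equiv_symm_apply_f_zero
            (C := CochainComplex.of J e hee) (kernel.ι (e 0)) _).symm
        · refine (Category.id_comp _).trans (Eq.trans ?_ (Category.comp_id _).symm)
          exact (CochainComplex.of_d J e 0).symm
      all_goals rfl
    | succ i =>
      rw [quasiIsoAt_iff_exactAt]
      · rw [HomologicalComplex.exactAt_iff' _ i (i + 1) (i + 1 + 1) (by simp) (by simp)]
        simp only [HomologicalComplex.sc', HomologicalComplex.shortComplexFunctor',
          CochainComplex.of_d]
        exact hex i
      · apply CochainComplex.exactAt_succ_single_obj⟩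

theorem resolutionOfExact_d (hJ : ∀ i, Injective (J i)) (hee : ∀ i, e i ≫ e (i + 1) = 0)
    (hex : ∀ i, (ShortComplex.mk _ _ (hee i)).Exact) (i : ℕ) :
    (resolutionOfExact J e hJ hee hex).cocomplex.d i (i + 1) = e i :=
  CochainComplex.of_d J e i

end

/-! ### Cochains into an injective resolution as families of maps -/

section

open CochainComplex.HomComplex

variable {C : Type*} [Category* C] [Abelian C] {M : C} (R : InjectiveResolution M)
  {N : CochainComplex C ℤ}

/-- The cochain with given components. -/
def cochainOfFamily {n : ℤ} (φ : ∀ (i : ℕ) (p : ℤ), p + n = i → (N.X p ⟶ R.cocomplex.X i)) :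
    Cochain N R.cochainComplex n :=
  Cochain.mk fun p q hpq => match q, hpq with
    | Int.ofNat i, h => φ i p h ≫ (R.cochainComplexXIso (i : ℤ) i rfl).inv
    | Int.negSucc _, _ => 0

theorem cochainOfFamily_v {n : ℤ}
    (φ : ∀ (i : ℕ) (p : ℤ), p + n = i → (N.X p ⟶ R.cocomplex.X i)) (i : ℕ) (p : ℤ)
    (h : p + n = i) : (cochainOfFamily R φ).v p i h =
      φ i p h ≫ (R.cochainComplexXIso (i : ℤ) i rfl).inv := rfl

/-- The resolution vanishes in negative degrees, so `h1` covers the components landing in degree `i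
+ 1`, and in degree `0` only the term with the differential of `N` survives, which is `h0`. -/
theorem δ_cochainOfFamily {n : ℤ}
    (φ : ∀ (i : ℕ) (p : ℤ), p + n = i → (N.X p ⟶ R.cocomplex.X i))
    (h0 : ∀ (p : ℤ) (h : p + 1 + n = (0 : ℕ)), N.d p (p + 1) ≫ φ 0 (p + 1) h = 0)
    (h1 : ∀ (i : ℕ) (p : ℤ) (h : p + n = i),
      N.d p (p + 1) ≫ φ (i + 1) (p + 1) (by push_cast; lia) =
        n.negOnePow • φ i p h ≫ R.cocomplex.d i (i + 1)) :
    δ n (n + 1) (cochainOfFamily R φ) = 0 := by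
  ext p q hpq
  obtain hq | ⟨i, rfl⟩ | rfl : q < 0 ∨ (∃ i : ℕ, q = (i + 1 : ℕ)) ∨ q = (0 : ℕ) := by
    rcases q with (_ | i) | i
    · exact Or.inr (Or.inr rfl)
    · exact Or.inr (Or.inl ⟨i, rfl⟩)
    · exact Or.inl (Int.negSucc_lt_zero i)
  · exact (CochainComplex.isZero_of_isStrictlyGE _ 0 _ hq).eq_of_tgt _ _
  · rw [δ_v n (n + 1) rfl _ p _ hpq i (p + 1) (by push_cast; lia) rfl, cochainOfFamily_v,
      cochainOfFamily_v, R.cochainComplex_d i (i + 1 : ℕ) i (i + 1) rfl rfl, Category.assoc,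
      Iso.inv_hom_id_assoc, ← Category.assoc (N.d _ _), h1 i p (by push_cast at hpq; lia),
      Int.negOnePow_succ]
    simp [smul_smul]
  · have hz : ∀ f : N.X p ⟶ R.cochainComplex.X (-1), f = 0 := fun f =>
      (CochainComplex.isZero_of_isStrictlyGE _ 0 _ (by lia)).eq_of_tgt _ _
    rw [δ_v n (n + 1) rfl _ p _ hpq (-1) (p + 1) (by simp) rfl, hz (Cochain.v _ _ _ _),
      cochainOfFamily_v, ← Category.assoc (N.d _ _), h0 p (by push_cast at hpq ⊢; lia)]
    simp

theorem exists_family_of_δ_eq {n m : ℤ} (hm : m + 1 = n)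
    (φ : ∀ (i : ℕ) (p : ℤ), p + n = i → (N.X p ⟶ R.cocomplex.X i))
    (α : Cochain N R.cochainComplex m) (hα : δ m n α = cochainOfFamily R φ) :
    ∃ a : ∀ (i : ℕ) (p : ℤ), p + n = i + 1 → (N.X p ⟶ R.cocomplex.X i),
      (∀ (p : ℤ) (h : p + n = (0 : ℕ)), φ 0 p h =
        n.negOnePow • N.d p (p + 1) ≫ a 0 (p + 1) (by push_cast at h ⊢; lia)) ∧
      ∀ (i : ℕ) (p : ℤ) (h : p + n = (i + 1 : ℕ)), φ (i + 1) p h =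
        a i p (by push_cast at h; lia) ≫ R.cocomplex.d i (i + 1) +
          n.negOnePow • N.d p (p + 1) ≫ a (i + 1) (p + 1) (by push_cast at h ⊢; lia) := by
  refine ⟨fun i p h => α.v p i (by lia) ≫ (R.cochainComplexXIso (i : ℤ) i rfl).hom,
    fun p h => ?_, fun i p h => ?_⟩
  · have hz : ∀ f : N.X p ⟶ R.cochainComplex.X (-1), f = 0 := fun f =>
      (CochainComplex.isZero_of_isStrictlyGE _ 0 _ (by lia)).eq_of_tgt _ _
    have := Cochain.congr_v hα p (0 : ℕ) h
    rw [cochainOfFamily_v, δ_v m n hm _ p _ h (-1) (p + 1) (by simp) rfl,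
      hz (Cochain.v _ _ _ _)] at this
    rw [← cancel_mono (R.cochainComplexXIso ((0 : ℕ) : ℤ) 0 rfl).inv, ← this]
    simp
  · have := Cochain.congr_v hα p (i + 1 : ℕ) h
    rw [cochainOfFamily_v, δ_v m n hm _ p _ h i (p + 1) (by push_cast; lia) rfl,
      R.cochainComplex_d i (i + 1 : ℕ) i (i + 1) rfl rfl] at this
    rw [← cancel_mono (R.cochainComplexXIso ((i + 1 : ℕ) : ℤ) (i + 1) rfl).inv, ← this]
    simp

end

/-! ### Functionals on the contratensor product with a dual complex -/

section

variable {k : Type u} [Field k] {D : Type u} [AddCommGroup D] [Module k D] [Coalgebra k D]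

theorem map_units_smul {V W : Type*} [AddCommGroup V] [Module k V] [AddCommGroup W] [Module k W]
    (f : V →ₗ[k] W) (u : ℤˣ) (x : V) : f (u • x) = u • f x := by
  obtain rfl | rfl := Int.units_eq_one_or u <;> simp

theorem evalFunctional_comp_left {N N' J : RightComod k D} (f : N ⟶ N') (φ : N' ⟶ J)
    (z : contratensorObj N (dualContra J)) :
    evalFunctional (f ≫ φ) z = evalFunctional φ (ctLeft f _ z) :=
  LinearMap.congr_fun (ct_hom_ext (f := evalFunctional (f ≫ φ))
    (g := evalFunctional φ ∘ₗ ctLeft f _) fun _ _ => rfl) z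

theorem evalFunctional_comp_right {N J J' : RightComod k D} (φ : N ⟶ J) (e : J ⟶ J')
    (z : contratensorObj N (dualContra J')) :
    evalFunctional (φ ≫ e) z = evalFunctional φ (ctRight N (dualMap e) z) :=
  LinearMap.congr_fun (ct_hom_ext (f := evalFunctional (φ ≫ e))
    (g := evalFunctional φ ∘ₗ ctRight N (dualMap e)) fun _ _ => rfl) z

theorem evalFunctional_add {N J : RightComod k D} (φ φ' : N ⟶ J)
    (z : contratensorObj N (dualContra J)) :
    evalFunctional (φ + φ') z = evalFunctional φ z + evalFunctional φ' z :=
  LinearMap.congr_fun (ct_hom_ext (f := evalFunctional (φ + φ'))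
    (g := evalFunctional φ + evalFunctional φ')
    fun n (p : J.A →ₗ[k] k) => p.map_add (φ.f.hom n) (φ'.f.hom n)) z

theorem evalFunctional_zero {N J : RightComod k D} (z : contratensorObj N (dualContra J)) :
    evalFunctional (0 : N ⟶ J) z = 0 := by
  simpa using evalFunctional_add (0 : N ⟶ J) 0 z

theorem evalFunctional_units_smul {N J : RightComod k D} (u : ℤˣ) (φ : N ⟶ J)
    (z : contratensorObj N (dualContra J)) :
    evalFunctional (u • φ) z = u • evalFunctional φ z := by
  have h := fun (φ : N ⟶ J) => (AddMonoidHom.mk' (fun φ : N ⟶ J => evalFunctional φ z)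
    (fun φ φ' => evalFunctional_add φ φ' z)).map_neg φ
  obtain rfl | rfl := Int.units_eq_one_or u
  · simp
  · simpa using h φ

theorem eq_of_evalFunctional_eq {N J : RightComod k D} {φ φ' : N ⟶ J}
    (h : ∀ z, evalFunctional φ z = evalFunctional φ' z) : φ = φ' := by
  refine RightComod.hom_ext fun n => ?_
  rw [← sub_eq_zero, ← Module.forall_dual_apply_eq_zero_iff k]
  intro p
  rw [map_sub, sub_eq_zero]
  exact h (ctMk N (dualContra J) n p)

theorem FinCofree.exists_evalFunctional_eq {N J : RightComod k D} (hJ : FinCofree J)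
    (ψ : contratensorObj N (dualContra J) →ₗ[k] k) : ∃ φ : N ⟶ J, evalFunctional φ = ψ := by
  obtain ⟨φ, hφ⟩ := hJ.exists_hom_eq_functional ψ
  exact ⟨φ, ct_hom_ext fun n p => (hφ n p).symm⟩

theorem dualMap_units_smul {N J : RightComod k D} (u : ℤˣ) (φ : N ⟶ J) :
    dualMap (u • φ) = u • dualMap φ := by
  have h := (AddMonoidHom.mk' (fun φ : N ⟶ J => dualMap φ) dualMap_add).map_neg φ
  obtain rfl | rfl := Int.units_eq_one_or u
  · simp
  · simpa using h

theorem ctRight_units_smul {N : RightComod k D} {P P' : LeftContra k D} (u : ℤˣ) (g : P ⟶ P')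
    (z : contratensorObj N P) : ctRight N (u • g) z = u • ctRight N g z := by
  have h := (AddMonoidHom.mk' (fun g : P ⟶ P' => ctRight N g z)
    (fun g g' => ctRight_add N g g' z)).map_neg g
  obtain rfl | rfl := Int.units_eq_one_or u
  · simp
  · simpa using h

theorem ctLeft_add {N N' : RightComod k D} {P : LeftContra k D} (f g : N ⟶ N')
    (z : contratensorObj N P) : ctLeft (f + g) P z = ctLeft f P z + ctLeft g P z :=
  LinearMap.congr_fun (ct_hom_ext (f := ctLeft (f + g) P) (g := ctLeft f P + ctLeft g P)
    fun n p => LinearMap.map_add₂ (ctMk N' P) (f.f.hom n) (g.f.hom n) p) z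

theorem ctLeft_units_smul {N N' : RightComod k D} {P : LeftContra k D} (u : ℤˣ) (f : N ⟶ N')
    (z : contratensorObj N P) : ctLeft (u • f) P z = u • ctLeft f P z := by
  have h := (AddMonoidHom.mk' (fun f : N ⟶ N' => ctLeft f P z)
    (fun f f' => ctLeft_add f f' z)).map_neg f
  obtain rfl | rfl := Int.units_eq_one_or u
  · simp
  · simpa using h

/-- The functionals `ψ` form a cocycle with values in an injective resolution, hence a coboundary of
some `a`. Evaluating a coboundary on the cycle `w` gives a telescoping sum. -/
theorem sum_functional_eq_zero {N : CochainComplex (RightComod k D) ℤ} {hN : IsFiniteComplex N}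
    {d : ℤ} (hd : ProjDimLE N hN d) {n : ℤ} (hn : d < n) {J : ℕ → RightComod k D}
    (hJ : ∀ i, FinCofree (J i)) {e : ∀ i, J i ⟶ J (i + 1)}
    (hex : ∀ i, Function.Exact (e i).f.hom (e (i + 1)).f.hom)
    (ψ : ∀ (i : ℕ) (p : ℤ), p + n = i → (contratensorObj (N.X p) (dualContra (J i)) →ₗ[k] k))
    (hψ0 : ∀ (p : ℤ) (h : p + 1 + n = (0 : ℕ)) z, ψ 0 (p + 1) h (ctLeft (N.d p (p + 1)) _ z) = 0)
    (hψ : ∀ (i : ℕ) (p : ℤ) (h : p + n = i) z,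
      ψ (i + 1) (p + 1) (by push_cast; lia) (ctLeft (N.d p (p + 1)) _ z) +
        p.negOnePow • ψ i p h (ctRight _ (dualMap (e i)) z) = 0)
    (w : ∀ i : ℕ, contratensorObj (N.X (i - n)) (dualContra (J i)))
    (hw : ∀ i : ℕ, ctLeft (((i : ℤ) - n + 1).negOnePow • N.d (i - n) ((i + 1 : ℕ) - n)) _ (w i) +
      ctRight _ (dualMap (e i)) (w (i + 1)) = 0) (m : ℕ) (hm : w m = 0) :
    ∑ i ∈ Finset.range (m + 1), ψ i (i - n) (sub_add_cancel _ n) (w i) = 0 := by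
  have hq1 : ∀ {p q : ℤ} {i : ℕ}, p + n = i → p + 1 = q → q + n = i + 1 := by lia
  have hee : ∀ i, e i ≫ e (i + 1) = 0 := fun i =>
    RightComod.hom_ext fun x => (hex i _).2 ⟨x, rfl⟩
  -- The signs reconcile the total complex, where the second differential carries `(-1)^p`, with the
  -- Hom complex, where the sign is `(-1)^n`; they agree because `p + n = i`. Exactness is
  -- unaffected.
  let s : ℕ → ℤˣ := fun i => ((i : ℤ) + 1).negOnePow
  have hss : ∀ i, (s i • e i) ≫ (s (i + 1) • e (i + 1)) = 0 := fun i => by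
    rw [Linear.units_smul_comp, Linear.comp_units_smul, hee, smul_zero, smul_zero]
  have hsex : ∀ i, (ShortComplex.mk _ _ (hss i)).Exact := fun i => by
    refine (RightComod.exact_iff _).2 ?_
    have hs : ∀ i x, (s i • e i).f.hom x = s i • (e i).f.hom x := fun i x => by
      obtain h | h := Int.units_eq_one_or (s i) <;> rw [h]
      · simp
      · rw [Units.neg_smul, Units.neg_smul, one_smul, one_smul]
        rfl
    intro y
    refine (Eq.congr_left (hs (i + 1) y)).trans ((smul_eq_zero_iff_eq _).trans ((hex i y).trans
      ⟨?_, ?_⟩))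
    · rintro ⟨x, rfl⟩
      exact ⟨s i • x, by
        refine (hs i _).trans ?_
        rw [map_units_smul, smul_smul, Int.units_mul_self, one_smul]⟩
    · rintro ⟨x, rfl⟩
      exact ⟨s i • x, by
        refine Eq.trans ?_ (hs i x).symm
        rw [map_units_smul]⟩
  let R := resolutionOfExact J (fun i => s i • e i) (fun i => (hJ i).injective) hss hsex
  choose φ hφ using fun i p h => (hJ i).exists_evalFunctional_eq (ψ i p h)
  let φ' : ∀ (i : ℕ) (p : ℤ), p + n = i → (N.X p ⟶ R.cocomplex.X i) := φ
  have hR : ∀ i, R.cocomplex.d i (i + 1) = s i • e i := fun i => resolutionOfExact_d J _ _ _ _ i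
  have hδ : CochainComplex.HomComplex.δ n (n + 1) (cochainOfFamily R φ') = 0 := by
    refine δ_cochainOfFamily R φ' (fun p h => ?_) (fun i p h => ?_)
    · refine eq_of_evalFunctional_eq (J := J 0) fun z => ?_
      refine (evalFunctional_comp_left (N.d p (p + 1)) (φ 0 (p + 1) h) z).trans ?_
      rw [hφ, hψ0]
      exact (evalFunctional_zero z).symm
    · rw [hR]
      refine eq_of_evalFunctional_eq (J := J (i + 1)) fun z => ?_
      refine (evalFunctional_comp_left (N.d p (p + 1)) (φ (i + 1) (p + 1) _) z).trans ?_
      refine Eq.trans ?_ (evalFunctional_units_smul _ (φ i p h ≫ (s i • e i)) z).symm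
      rw [evalFunctional_comp_right, dualMap_units_smul, ctRight_units_smul, hφ, hφ,
        eq_neg_of_add_eq_zero_left (hψ i p h z), map_units_smul, smul_smul, ← Units.neg_smul]
      congr 1
      rw [← Int.negOnePow_add, ← Int.negOnePow_succ, Int.negOnePow_eq_iff]
      exact ⟨-n, by lia⟩
  obtain ⟨α, hα⟩ := exists_cochain_of_projDimLE hd R (sub_add_cancel n 1) hn
    (CochainComplex.HomComplex.Cocycle.mk (cochainOfFamily R φ') (n + 1) rfl hδ)
  obtain ⟨a, ha0, ha⟩ := exists_family_of_δ_eq R (sub_add_cancel n 1) φ' α hα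
  let a' : ∀ (i : ℕ) (p : ℤ), p + n = i + 1 → (N.X p ⟶ J i) := a
  have hψa0 : ∀ (p q : ℤ) (h : p + n = (0 : ℕ)) (hq : p + 1 = q) z, ψ 0 p h z =
      n.negOnePow • evalFunctional (a' 0 q (hq1 h hq)) (ctLeft (N.d p q) _ z) := by
    rintro p _ h rfl z
    rw [← evalFunctional_comp_left, ← evalFunctional_units_smul, ← hφ]
    exact congrArg (fun f : N.X p ⟶ J 0 => evalFunctional f z) (ha0 p h)
  have hψa : ∀ (i : ℕ) (p q : ℤ) (h : p + n = (i + 1 : ℕ)) (hq : p + 1 = q) z,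
      ψ (i + 1) p h z = s i • evalFunctional (a' i p (h.trans (Nat.cast_succ i)))
          (ctRight _ (dualMap (e i)) z) +
        n.negOnePow • evalFunctional (a' (i + 1) q (hq1 h hq))
          (ctLeft (N.d p q) _ z) := by
    rintro i p _ h rfl z
    rw [← evalFunctional_comp_left, ← evalFunctional_comp_right, ← evalFunctional_units_smul,
      ← evalFunctional_units_smul, ← Linear.comp_units_smul, ← evalFunctional_add, ← hφ, ← hR]
    exact congrArg (fun f : N.X p ⟶ J (i + 1) => evalFunctional f z) (ha i p h)
  -- Each partial sum leaves one boundary term, which the cycle relation `hw` cancels against the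
  -- next summand. At `j = m` it vanishes because `w m = 0`.
  have key : ∀ j : ℕ, ∑ i ∈ Finset.range (j + 1), ψ i (i - n) (sub_add_cancel _ n) (w i) =
      n.negOnePow • evalFunctional (a' j ((j + 1 : ℕ) - n) (by push_cast; ring))
        (ctLeft (N.d (j - n) ((j + 1 : ℕ) - n)) _ (w j)) := by
    intro j
    induction j with
    | zero =>
      rw [Finset.sum_range_succ, Finset.sum_range_zero, zero_add]
      exact hψa0 _ _ _ (by push_cast; ring) _
    | succ j ih =>
      rw [Finset.sum_range_succ, ih, hψa j _ ((j + 1 + 1 : ℕ) - n) _ (by push_cast; ring),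
        eq_neg_of_add_eq_zero_right (hw j), ctLeft_units_smul, map_neg, map_units_smul, smul_neg,
        smul_smul]
      have hsn : s j * ((j : ℤ) - n + 1).negOnePow = n.negOnePow := by
        rw [← Int.negOnePow_add, Int.negOnePow_eq_iff]
        exact ⟨j + 1 - n, by ring⟩
      rw [hsn, add_neg_cancel_left]
  rw [key, hm, map_zero, map_zero, smul_zero]

end

/-! ### The total complex of the contratensor product -/

section

variable {k : Type u} [Field k] {D : Type u} [AddCommGroup D] [Module k D] [Coalgebra k D]
  (N : CochainComplex (RightComod k D) ℤ) (F : CochainComplex (LeftContra k D) ℤ)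

/-- The total complex of `N ⊙_D F`. -/
abbrev ctTot : CochainComplex (ModuleCat.{u} k) ℤ :=
  HomologicalComplex.mapBifunctor N F (contratensor k D) (ComplexShape.up ℤ)

/-- The inclusion of a summand in the total complex. -/
def totι (p q j : ℤ) (h : p + q = j) : contratensorObj (N.X p) (F.X q) →ₗ[k] (ctTot N F).X j :=
  (HomologicalComplex.ιMapBifunctor N F (contratensor k D) (ComplexShape.up ℤ) p q j h).hom

theorem ctTot_d_totι {p p' q q' j j' : ℤ} (h : p + q = j) (hp : p + 1 = p') (hq : q + 1 = q')
    (hj : j + 1 = j') (x : contratensorObj (N.X p) (F.X q)) :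
    ((ctTot N F).d j j').hom (totι N F p q j h x) =
      totι N F p' q j' (by lia) (ctLeft (N.d p p') _ x) +
        p.negOnePow • totι N F p q' j' (by lia) (ctRight _ (F.d q q') x) := by
  have h1 : HomologicalComplex.ιMapBifunctor N F (contratensor k D) (ComplexShape.up ℤ) p q j h ≫
      (ctTot N F).d j j' =
      (((contratensor k D).map (N.d p p')).app (F.X q) ≫
        HomologicalComplex.ιMapBifunctor N F (contratensor k D) (ComplexShape.up ℤ) p' q j'
          (show p' + q = j' by lia)) +
      p.negOnePow • (((contratensor k D).obj (N.X p)).map (F.d q q') ≫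
        HomologicalComplex.ιMapBifunctor N F (contratensor k D) (ComplexShape.up ℤ) p q' j'
          (show p + q' = j' by lia)) := by
    rw [HomologicalComplex.mapBifunctor.d_eq, Preadditive.comp_add,
      HomologicalComplex.mapBifunctor.ι_D₁, HomologicalComplex.mapBifunctor.ι_D₂,
      HomologicalComplex.mapBifunctor.d₁_eq _ _ _ _ (show (ComplexShape.up ℤ).Rel p p' from hp) _ _
        (show p' + q = j' by lia),
      HomologicalComplex.mapBifunctor.d₂_eq _ _ _ _ _ (show (ComplexShape.up ℤ).Rel q q' from hq) _
        (show p + q' = j' by lia)]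
    congr 1
    exact one_smul ℤˣ _
  refine (LinearMap.congr_fun (congrArg ModuleCat.Hom.hom h1) x).trans ?_
  obtain hs | hs := Int.units_eq_one_or p.negOnePow <;> rw [hs]
  · rw [one_smul, one_smul]
    rfl
  · rw [Units.neg_smul, Units.neg_smul, one_smul, one_smul]
    rfl

variable {N F}

theorem ctTot_hom_ext {j : ℤ} {V : Type u} [AddCommGroup V] [Module k V]
    {f g : (ctTot N F).X j →ₗ[k] V}
    (h : ∀ p q (hpq : p + q = j), f ∘ₗ totι N F p q j hpq = g ∘ₗ totι N F p q j hpq) : f = g := by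
  have : ModuleCat.ofHom f = ModuleCat.ofHom g :=
    HomologicalComplex.mapBifunctor.hom_ext fun p q hpq => ModuleCat.hom_ext (h p q hpq)
  exact congrArg ModuleCat.Hom.hom this

variable (N F)

/-- The family of morphisms defining `totProj`. -/
def totProjFamily (p q j : ℤ) (h : p + q = j) (p' q' : ℤ) (h' : p' + q' = j) :
    contratensorObj (N.X p') (F.X q') ⟶ contratensorObj (N.X p) (F.X q) :=
  if hp : p' = p then contratensorMap (eqToHom (congrArg N.X hp))
    (eqToHom (congrArg F.X (show q' = q by lia))) else 0

/-- The projection onto a summand of the total complex. -/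
def totProj (p q j : ℤ) (h : p + q = j) : (ctTot N F).X j →ₗ[k] contratensorObj (N.X p) (F.X q) :=
  ModuleCat.Hom.hom (HomologicalComplex.mapBifunctorDesc (K₁ := N) (K₂ := F)
    (F := contratensor k D) (c := ComplexShape.up ℤ) (totProjFamily N F p q j h) :
      (ctTot N F).X j ⟶ contratensorObj (N.X p) (F.X q))

theorem totProj_totι' (p q p' q' j : ℤ) (h : p + q = j) (h' : p' + q' = j)
    (x : contratensorObj (N.X p') (F.X q')) :
    totProj N F p q j h (totι N F p' q' j h' x) = (totProjFamily N F p q j h p' q' h').hom x :=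
  LinearMap.congr_fun (congrArg ModuleCat.Hom.hom
    (HomologicalComplex.ι_mapBifunctorDesc (K₁ := N) (K₂ := F) (F := contratensor k D)
      (c := ComplexShape.up ℤ) (totProjFamily N F p q j h) p' q' h')) x

theorem totProj_totι (p q j : ℤ) (h : p + q = j) (x : contratensorObj (N.X p) (F.X q)) :
    totProj N F p q j h (totι N F p q j h x) = x := by
  rw [totProj_totι', totProjFamily, dif_pos rfl]
  exact LinearMap.congr_fun (congrArg ModuleCat.Hom.hom
    (((contratensor k D).obj (N.X p)).map_id (F.X q))) x

theorem totProj_totι_of_ne (p q p' q' j : ℤ) (h : p + q = j) (h' : p' + q' = j) (hp : p' ≠ p)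
    (x : contratensorObj (N.X p') (F.X q')) :
    totProj N F p q j h (totι N F p' q' j h' x) = 0 := by
  rw [totProj_totι', totProjFamily, dif_neg hp]
  rfl

variable {N F}

/-! ### Cycles and exactness of the total complex -/

theorem ctTot_exists_eq_sum [F.IsStrictlyLE 0] (n : ℤ) (x : (ctTot N F).X (-n)) :
    ∃ (m : ℕ) (z : ∀ i : ℕ, contratensorObj (N.X (i - n)) (F.X (-i))),
      (∀ i, m ≤ i → z i = 0) ∧ ∀ M, m ≤ M →
        x = ∑ i ∈ Finset.range M, totι N F (i - n) (-i) (-n) (by ring) (z i) := by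
  let U : Submodule k ((ctTot N F).X (-n)) :=
    ⨆ i : ℕ, LinearMap.range (totι N F (i - n) (-i) (-n) (by ring))
  have hU : U = ⊤ := by
    rw [← U.ker_mkQ, LinearMap.ker_eq_top]
    refine ctTot_hom_ext fun p q hpq => ?_
    obtain hq | ⟨i, rfl⟩ : 0 < q ∨ ∃ i : ℕ, q = -i := by
      rcases lt_or_ge 0 q with h | h
      · exact Or.inl h
      · exact Or.inr (Int.exists_eq_neg_ofNat h)
    · refine ct_hom_ext fun y r => ?_
      have hz : 𝟙 (F.X q) = 0 :=
        (CochainComplex.isZero_of_isStrictlyLE F 0 q hq).eq_of_src _ _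
      have hr : r = 0 := congrArg (fun g : F.X q ⟶ F.X q => g.f.hom r) hz
      rw [hr, map_zero, map_zero, map_zero]
    · obtain rfl : p = i - n := by lia
      ext y
      refine (Submodule.Quotient.mk_eq_zero U).2 ?_
      exact Submodule.mem_iSup_of_mem i ⟨y, rfl⟩
  obtain ⟨f, hf, hfx⟩ := (Submodule.mem_iSup_iff_exists_finsupp _ x).1 (hU ▸ Submodule.mem_top : x ∈ U)
  choose z hz using hf
  classical
  obtain ⟨m, hm⟩ := f.support.bddAbove
  refine ⟨m + 1, fun i => if i ∈ f.support then z i else 0, fun i hi => ?_, fun M hM => ?_⟩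
  · refine if_neg fun h => ?_
    have := hm h
    lia
  · rw [← hfx]
    refine (Finsupp.sum_of_support_subset f (s := Finset.range M) (fun i hi => ?_) _
      fun _ _ => rfl).trans (Finset.sum_congr rfl fun i _ => ?_)
    · have := hm hi
      simp only [Finset.mem_range]
      lia
    · dsimp only
      split_ifs with h
      · exact (hz i).symm
      · rw [map_zero, Finsupp.notMem_support_iff.1 h]

/-- The component of `dx` in bidegree `(i + 1 - n, -i)` receives contributions from `z i` and `z (i
+ 1)` only. The sign of the second is moved onto the differential of `N`. -/
theorem ctTot_cycle_relation {n j : ℤ} (hj : -n + 1 = j) {m : ℕ}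
    {z : ∀ i : ℕ, contratensorObj (N.X (i - n)) (F.X (-i))} {x : (ctTot N F).X (-n)}
    (hx : ∀ M, m ≤ M → x = ∑ i ∈ Finset.range M, totι N F (i - n) (-i) (-n) (by ring) (z i))
    (hdx : ((ctTot N F).d (-n) j).hom x = 0) (i : ℕ) :
    ctLeft (((i : ℤ) - n + 1).negOnePow • N.d (i - n) ((i + 1 : ℕ) - n)) _ (z i) +
      ctRight _ (F.d (-((i + 1 : ℕ) : ℤ)) (-i)) (z (i + 1)) = 0 := by
  let t : ℕ → contratensorObj (N.X ((i + 1 : ℕ) - n)) (F.X (-i)) := fun l =>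
    totProj N F ((i + 1 : ℕ) - n) (-i) j (by push_cast; lia) (((ctTot N F).d (-n) j).hom
      (totι N F (l - n) (-l) (-n) (by ring) (z l)))
  have h1 : t i = ctLeft (N.d (i - n) ((i + 1 : ℕ) - n)) _ (z i) := by
    simp only [t]
    rw [ctTot_d_totι N F _ (p' := (i + 1 : ℕ) - n) (by push_cast; ring) rfl hj, map_add,
      totProj_totι, map_units_smul, totProj_totι_of_ne _ _ _ _ _ _ _ _ _ (by push_cast; lia),
      smul_zero, add_zero]
  have h2 : t (i + 1) = ((i : ℤ) - n + 1).negOnePow •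
      ctRight _ (F.d (-((i + 1 : ℕ) : ℤ)) (-i)) (z (i + 1)) := by
    simp only [t]
    rw [ctTot_d_totι N F _ rfl (q' := -(i : ℤ)) (by push_cast; ring) hj, map_add,
      totProj_totι_of_ne _ _ _ _ _ _ _ _ _ (by push_cast; lia), map_units_smul, totProj_totι,
      zero_add]
    congr 2
    push_cast
    ring
  have h3 : ∀ l, l ≠ i ∧ l ≠ i + 1 → t l = 0 := fun l hl => by
    simp only [t]
    rw [ctTot_d_totι N F _ rfl rfl hj, map_add, map_units_smul,
      totProj_totι_of_ne _ _ _ _ _ _ _ _ _ (by omega),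
      totProj_totι_of_ne _ _ _ _ _ _ _ _ _ (by omega), smul_zero, add_zero]
  have h : t i + t (i + 1) = 0 := by
    -- The range must reach `m`, so that the sum is `x`, and contain both `i` and `i + 1`.
    rw [← Finset.sum_eq_add (s := Finset.range (m + (i + 2))) i (i + 1) (by lia)
      (fun l _ hl => h3 l hl) (fun h => by simp at h; lia) (fun h => by simp at h; lia)]
    simp only [t]
    rw [← map_sum, ← map_sum, ← hx _ (by lia), hdx, map_zero]
  rw [h1, h2] at h
  have h' := congrArg (((i : ℤ) - n + 1).negOnePow • ·) h
  rwa [smul_zero, smul_add, smul_smul, Int.units_mul_self, one_smul, ← ctLeft_units_smul] at h'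

theorem ctTot_exactAt (hcocoh : IsRightCocoherent k D) (hcoNoeth : IsLeftCoNoetherian k D)
    (hN : IsFiniteComplex N) {d : ℤ} (hd : ProjDimLE N hN d) [F.IsStrictlyLE 0] [F.IsGE 0]
    (hF : ∀ q, Projective (F.X q)) {n : ℤ} (hn : d < n) : (ctTot N F).ExactAt (-n) := by
  rw [HomologicalComplex.exactAt_iff' _ (-n - 1) (-n) (-n + 1) (by simp) (by simp),
    ShortComplex.moduleCat_exact_iff]
  intro x hx
  by_contra hmem
  -- Over a field, a vector outside the boundaries is detected by a functional that kills them.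
  obtain ⟨Λ, hΛx, hΛ⟩ := Submodule.exists_le_ker_of_notMem
    (p := LinearMap.range ((ctTot N F).d (-n - 1) (-n)).hom) (v := x) hmem
  have hΛ0 : ∀ y, Λ (((ctTot N F).d (-n - 1) (-n)).hom y) = 0 := fun y => hΛ ⟨y, rfl⟩
  obtain ⟨m, z, hz0, hxz⟩ := ctTot_exists_eq_sum n x
  have hFex : ∀ i : ℕ, Function.Exact (F.d (-((i + 1 + 1 : ℕ) : ℤ)) (-((i + 1 : ℕ) : ℤ))).f.hom
      (F.d (-((i + 1 : ℕ) : ℤ)) (-(i : ℤ))).f.hom := fun i => by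
    have := F.exactAt_of_isGE 0 (-((i + 1 : ℕ) : ℤ)) (by lia)
    rw [HomologicalComplex.exactAt_iff' _ (-((i + 1 + 1 : ℕ) : ℤ)) _ (-(i : ℤ))
      (by simp; ring) (by simp)] at this
    exact (LeftContra.exact_iff _).1 this
  obtain ⟨J, hJ, e, f, w, hee, hef, hfw, hw, hw0⟩ := hcoNoeth.exists_lift_cycle m
    (fun i => F.X (-(i : ℤ))) (fun i => hF _) (fun i => F.d _ _) (fun i => F.d_comp_d _ _ _)
    (fun i => N.X (i - n)) (fun i => ((i : ℤ) - n + 1).negOnePow • N.d (i - n) ((i + 1 : ℕ) - n))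
    z hz0 (ctTot_cycle_relation rfl hxz hx)
  obtain ⟨J', hJ', e', κ, f', hκ, hef', hκf, hex⟩ := hcocoh.exists_factor_exact hFex hJ hee hef
  -- Here `Λ` is pulled back to the contratensor product with the dual of the exact complex `J'`,
  -- and evaluated on the image of the lifted cycle.
  have hsum := sum_functional_eq_zero hd hn hJ' hex
    (fun i p h => Λ ∘ₗ totι N F p (-i) (-n) (by lia) ∘ₗ ctRight _ (f' i))
    (fun p h y => ?_) (fun i p h y => ?_) (fun i => ctRight _ (dualMap (κ i)) (w i))
    (fun i => ?_) m (by rw [hw0 m le_rfl, map_zero])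
  · refine hΛx ((congrArg Λ (hxz (m + 1) (Nat.le_succ m))).trans ?_)
    rw [map_sum, ← hsum]
    refine Finset.sum_congr rfl fun i _ => ?_
    simp only [LinearMap.comp_apply]
    rw [← ctRight_comp, hκf, hfw]
  · have := hΛ0 (totι N F p (-(0 : ℕ)) _ (by lia) (ctRight _ (f' 0) y))
    have h0 : F.d (-((0 : ℕ) : ℤ)) 1 = 0 :=
      (CochainComplex.isZero_of_isStrictlyLE F 0 1 zero_lt_one).eq_of_tgt _ _
    rw [ctTot_d_totι N F _ rfl (q' := 1) (by simp) (by ring), h0, ctRight_zero, map_zero,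
      smul_zero, add_zero, ctLeft_ctRight] at this
    exact this
  · have := hΛ0 (totι N F p (-((i + 1 : ℕ) : ℤ)) _ (by push_cast; lia) (ctRight _ (f' (i + 1)) y))
    rw [ctTot_d_totι N F _ rfl (q' := -(i : ℤ)) (by push_cast; ring) (by ring), map_add,
      map_units_smul, ctLeft_ctRight, ← ctRight_comp, ← hef', ctRight_comp] at this
    exact this
  · rw [ctLeft_ctRight, ← ctRight_comp, ← dualMap_comp, ← hκ, dualMap_comp, ctRight_comp,
      ← map_add, hw, map_zero]

end

end

end ComodContra

theorem mainTheorem3 (k : Type u) [Field k] (D : Type u) [AddCommGroup D] [Module k D]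
    [Coalgebra k D] (hcocoh : ComodContra.IsRightCocoherent k D)
    (hcoNoeth : ComodContra.IsLeftCoNoetherian k D)
    (N : CochainComplex (ComodContra.RightComod k D) ℤ) (hN : ComodContra.IsFiniteComplex N)
    (d : ℤ) (hd : ComodContra.ProjDimLE N hN d) :
    ComodContra.ContraflatDimLE N d := by
  intro P n hn
  exact (ComodContra.ctTot_exactAt hcocoh hcoNoeth hN hd
    (F := (projectiveResolution P).cochainComplex) (fun _ => inferInstance) hn).isZero_homology
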